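/- Let $\mathcal U$ be a complex Hilbert space, $\Pi^N=\{z\in\mathbb C^N:\operatorname{Re}z_k>0,\ k=1,\dots,N\}$, $\Omega_N=\bigcup_{|\lambda|=1}(\lambda\Pi)^N$ and $\mathbb D^N=\{w\in\mathbb C^N:|w_k|<1,\ k=1,\dots,N\}$; $L(\mathcal U)$ is the space of bounded linear operators on $\mathcal U$. An anti-unitary involution (AUI) on a Hilbert space $\mathcal V$ is a map $\iota:\mathcal V\to\mathcal V$ with $\iota^2=I$ and $\langle\iota x,\iota y\rangle=\langle y,x\rangle$ for all $x,y$. An operator $A\in L(\mathcal V)$ is $\iota$-real if $\iota A=A\iota$; an $L(\mathcal V)$-valued function $g$ on a set invariant under coordinatewise complex conjugation is $\iota$-real if $\iota g(\bar z)\iota=g(z)$ for all $z$. (A kernel $\Phi(z,\zeta)$ is regarded as a function of the pair $(z,\zeta)$, so for it this reads $\iota\Phi(\bar z,\bar\zeta)\iota=\Phi(z,\zeta)$.) For a function $f:\Omega_N\to L(\mathcal U)$, a long-resolvent representation of $f$ consists of a Hilbert space $\mathcal H$ and positive semidefinite operators $A_k=A_k^*\in L(\mathcal U\oplus\mathcal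 H)$, $k=1,\dots,N$, such that, writing $$A(z)=z_1A_1+\dots+z_NA_N=\begin{bmatrix}a(z)&b(z)\\c(z)&d(z)\end{bmatrix},$$ the operator $d(z)$ is boundedly invertible and $f(z)=a(z)-b(z)d(z)^{-1}c(z)$ for all $z\in\Omega_N$. The Bessmertny\u{\i} class $\mathcal B_N(\mathcal U)$ consists of the holomorphic $L(\mathcal U)$-valued functions on $\Omega_N$ that have such a representation. A holomorphic PSD kernel on $\Pi^N\times\Pi^N$ is an $L(\mathcal U)$-valued function $\Phi(z,\zeta)$, holomorphic in $z$ and anti-holomorphic in $\zeta$, such that $\Phi(z,\zeta)=\Phi(\zeta,z)^*$ and $\sum_{\mu,\nu=1}^m\langle\Phi(z^{(\mu)},z^{(\nu)})u^{(\mu)},u^{(\nu)}\rangle\ge0$ for all $m$, all $z^{(1)},\dots,z^{(m)}\in\Pi^N$ and all $u^{(1)},\dots,u^{(m)}\in\mathcal U$. **Theorem.** Let $\iota=\iota_{\mathcal U}$ be an AUI on $\mathcal U$ and let $f$ be a holomorphic $L(\mathcal U)$-valued function on $\Omega_N$. The following conditions are equivalent: (i) $f\in\mathcal B_N(\mathcal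 U)$ and $f$ is $\iota_{\mathcal U}$-real on $\Omega_N$; (ii) there exist a long-resolvent representation of $f$ (with auxiliary Hilbert space $\mathcal H$ and pencil $A$) and an AUI $\iota_{\mathcal H}$ on $\mathcal H$ such that the function $A(z)$ is $(\iota_{\mathcal U}\oplus\iota_{\mathcal H})$-real on $\Omega_N$; (iii) there exist $\iota_{\mathcal U}$-real holomorphic PSD kernels $\Phi_1,\dots,\Phi_N$ on $\Pi^N\times\Pi^N$ such that $f(z)=\sum_{k=1}^Nz_k\Phi_k(z,\zeta)$ for all $(z,\zeta)\in\Pi^N\times\Pi^N$; (iv) for $F(w)=f\left(\frac{1+w_1}{1-w_1},\dots,\frac{1+w_N}{1-w_N}\right)$, the operator $F(w)+I_{\mathcal U}$ is boundedly invertible for every $w\in\mathbb D^N$, so that the double Cayley transform $\mathcal F(w)=(F(w)-I_{\mathcal U})(F(w)+I_{\mathcal U})^{-1}$ is defined on $\mathbb D^N$, and there exist a Hilbert space $\mathcal X=\bigoplus_{k=1}^N\mathcal X_k$ with orthogonal projections $P_k$ onto $\mathcal X_k$, an operator $$U=\begin{bmatrix}A&B\\C&D\end{bmatrix}\in L(\mathcal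 X\oplus\mathcal U)$$ that is both unitary and selfadjoint, and an AUI $\iota_{\mathcal X}$ on $\mathcal X$ that commutes with $P_1,\dots,P_N$, such that $U$ is $(\iota_{\mathcal X}\oplus\iota_{\mathcal U})$-real and $$\mathcal F(w)=D+CP(w)(I_{\mathcal X}-AP(w))^{-1}B,\qquad P(w)=\sum_{k=1}^Nw_kP_k,\qquad w\in\mathbb D^N.$$ -/

import Mathlib

open scoped ComplexOrder

universe u

namespace Bessmertnyi

noncomputable section

/-! ### Domains in `ℂ^N` (coordinatewise complex conjugation on `Fin N → ℂ` is `star`) -/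

/-- The open right polyhalfplane `Π^N`. -/
def polyHalfPlane (N : ℕ) : Set (Fin N → ℂ) := {z | ∀ k, 0 < (z k).re}

/-- `Ω_N`, the union over `|lam| = 1` of the polyhalfplanes `(lam Π)^N`. -/
def Omega (N : ℕ) : Set (Fin N → ℂ) :=
  {z | ∃ lam : ℂ, ‖lam‖ = 1 ∧ ∃ w ∈ polyHalfPlane N, z = lam • w}

/-- The open unit polydisk `𝔻^N`. -/
def polyDisk (N : ℕ) : Set (Fin N → ℂ) := {w | ∀ k, ‖w k‖ < 1}

/-! ### Anti-unitary involutions and real operators and functions -/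

/-- `ι` is an anti-unitary involution. In Mathlib `inner ℂ x y` is linear in `y`, so the
mathematician's `⟨x, y⟩` (linear in `x`) is `inner ℂ y x`; the condition below reads the same in
both conventions. -/
structure IsAUI {U : Type*} [NormedAddCommGroup U] [InnerProductSpace ℂ U] (ι : U → U) : Prop where
  involutive : ∀ x, ι (ι x) = x
  inner_map : ∀ x y, inner ℂ (ι x) (ι y) = inner ℂ y x

/-- A bounded operator `A` is `ι`-real if `ι A = A ι`. -/
def IsRealOp {U : Type*} [NormedAddCommGroup U] [InnerProductSpace ℂ U] (ι : U → U)
    (A : U →L[ℂ] U) : Prop :=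
  ∀ x, ι (A x) = A (ι x)

/-- An operator-valued function `f` on a set `Ω` is `ι`-real if `ι f(z̄) ι = f(z)` on `Ω`. -/
def IsRealFun {E U : Type*} [Star E] [NormedAddCommGroup U] [InnerProductSpace ℂ U] (ι : U → U)
    (Ω : Set E) (f : E → U →L[ℂ] U) : Prop :=
  ∀ z ∈ Ω, ∀ x, ι (f (star z) (ι x)) = f z x

/-! ### Hilbert space direct sums of two spaces and block operators -/

section Blocks

variable {G K : Type*} [NormedAddCommGroup G] [InnerProductSpace ℂ G]
  [NormedAddCommGroup K] [InnerProductSpace ℂ K]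

/-- The embedding of `G` as the first summand of the Hilbert space `G ⊕ K`. -/
def inl (G K : Type*) [NormedAddCommGroup G] [InnerProductSpace ℂ G]
    [NormedAddCommGroup K] [InnerProductSpace ℂ K] : G →L[ℂ] WithLp 2 (G × K) :=
  (WithLp.prodContinuousLinearEquiv 2 ℂ G K).symm.toContinuousLinearMap ∘L
    ContinuousLinearMap.inl ℂ G K

/-- The embedding of `K` as the second summand of the Hilbert space `G ⊕ K`. -/
def inr (G K : Type*) [NormedAddCommGroup G] [InnerProductSpace ℂ G]
    [NormedAddCommGroup K] [InnerProductSpace ℂ K] : K →L[ℂ] WithLp 2 (G × K) :=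
  (WithLp.prodContinuousLinearEquiv 2 ℂ G K).symm.toContinuousLinearMap ∘L
    ContinuousLinearMap.inr ℂ G K

/-- The blocks of an operator on `G ⊕ K`, as a matrix acting on columns. -/
def block₁₁ (A : WithLp 2 (G × K) →L[ℂ] WithLp 2 (G × K)) : G →L[ℂ] G :=
  WithLp.fstL 2 ℂ G K ∘L A ∘L inl G K

/-- The upper right block. -/
def block₁₂ (A : WithLp 2 (G × K) →L[ℂ] WithLp 2 (G × K)) : K →L[ℂ] G :=
  WithLp.fstL 2 ℂ G K ∘L A ∘L inr G K

/-- The lower left block. -/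
def block₂₁ (A : WithLp 2 (G × K) →L[ℂ] WithLp 2 (G × K)) : G →L[ℂ] K :=
  WithLp.sndL 2 ℂ G K ∘L A ∘L inl G K

/-- The lower right block. -/
def block₂₂ (A : WithLp 2 (G × K) →L[ℂ] WithLp 2 (G × K)) : K →L[ℂ] K :=
  WithLp.sndL 2 ℂ G K ∘L A ∘L inr G K

/-- The direct sum `ι ⊕ κ` of two (not necessarily linear) maps. -/
def sumMap (ι : G → G) (κ : K → K) (x : WithLp 2 (G × K)) : WithLp 2 (G × K) :=
  WithLp.toLp 2 (ι x.fst, κ x.snd)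

end Blocks

/-! ### Long resolvent representations and the Bessmertnyi class -/

section Class

variable {N : ℕ} {U : Type u} [NormedAddCommGroup U] [InnerProductSpace ℂ U]

/-- The homogeneous linear pencil `A(z) = z₁A₁ + ⋯ + z_N A_N`. -/
def pencil {V : Type*} [NormedAddCommGroup V] [InnerProductSpace ℂ V]
    (A : Fin N → V →L[ℂ] V) (z : Fin N → ℂ) : V →L[ℂ] V :=
  ∑ k, z k • A k

/-- `f(z) = a(z) - b(z) d(z)⁻¹ c(z)` on `Ω_N`, where `a, b, c, d` are the blocks of the pencil
`A(z)`, whose coefficients are positive semidefinite (`IsPositive` includes self-adjointness);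
that `d(z)` is boundedly invertible on `Ω_N` is part of the condition. -/
structure IsLongResolvent {H : Type*} [NormedAddCommGroup H] [InnerProductSpace ℂ H]
    (f : (Fin N → ℂ) → U →L[ℂ] U)
    (A : Fin N → WithLp 2 (U × H) →L[ℂ] WithLp 2 (U × H)) : Prop where
  psd : ∀ k, (A k).IsPositive
  isUnit : ∀ z ∈ Omega N, IsUnit (block₂₂ (pencil A z))
  eq : ∀ z ∈ Omega N, f z = block₁₁ (pencil A z) -
    block₁₂ (pencil A z) ∘L Ring.inverse (block₂₂ (pencil A z)) ∘L block₂₁ (pencil A z)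

/-- The Bessmertnyi class `𝓑_N(𝓤)`. -/
def IsBessmertnyi (f : (Fin N → ℂ) → U →L[ℂ] U) : Prop :=
  DifferentiableOn ℂ f (Omega N) ∧
    ∃ (H : Type u) (_ : NormedAddCommGroup H) (_ : InnerProductSpace ℂ H) (_ : CompleteSpace H)
      (A : Fin N → WithLp 2 (U × H) →L[ℂ] WithLp 2 (U × H)), IsLongResolvent f A

/-! ### Holomorphic positive semidefinite kernels -/

/-- `Φ(z, ζ)` is a holomorphic positive semidefinite kernel on `Ω × Ω`. -/
structure IsHolomorphicPSDKernel [CompleteSpace U] (Ω : Set (Fin N → ℂ))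
    (Φ : (Fin N → ℂ) → (Fin N → ℂ) → U →L[ℂ] U) : Prop where
  hermitian : ∀ z ∈ Ω, ∀ ζ ∈ Ω, Φ z ζ = ContinuousLinearMap.adjoint (Φ ζ z)
  nonneg : ∀ (m : ℕ) (z : Fin m → Fin N → ℂ) (v : Fin m → U), (∀ μ, z μ ∈ Ω) →
    0 ≤ ∑ μ, ∑ ν, inner ℂ (v ν) (Φ (z μ) (z ν) (v μ))
  holomorphic : ∀ ζ ∈ Ω, DifferentiableOn ℂ (fun z => Φ z ζ) Ω
  antiholomorphic : ∀ z ∈ Ω, DifferentiableOn ℂ (fun ζ => Φ z (star ζ)) {ζ | star ζ ∈ Ω}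

end Class

/-! ### Agler colligations and the double Cayley transform -/

section Agler

variable {N : ℕ} {U : Type u} [NormedAddCommGroup U] [InnerProductSpace ℂ U] [CompleteSpace U]

/-- An Agler unitary colligation with state space `X = ⊕ X_k` (an orthogonal sum of closed
subspaces of the Hilbert space `X`) and with input and output space `U`. -/
structure AglerColligation (N : ℕ) (U : Type u) [NormedAddCommGroup U] [InnerProductSpace ℂ U]
    [CompleteSpace U] where
  /-- the state space -/
  X : Type u
  [normedAddCommGroup : NormedAddCommGroup X]
  [innerProductSpace : InnerProductSpace ℂ X]
  [completeSpace : CompleteSpace X]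
  /-- the summands of the state space -/
  part : Fin N → Submodule ℂ X
  [completePart : ∀ k, CompleteSpace (part k)]
  isHilbertSum : IsHilbertSum ℂ (fun k => part k) (fun k => (part k).subtypeₗᵢ)
  /-- the colligation operator on `X ⊕ U` -/
  op : WithLp 2 (X × U) →L[ℂ] WithLp 2 (X × U)
  unitary : op ∈ unitary (WithLp 2 (X × U) →L[ℂ] WithLp 2 (X × U))

attribute [instance] AglerColligation.normedAddCommGroup AglerColligation.innerProductSpace
  AglerColligation.completeSpace AglerColligation.completePart

namespace AglerColligation

/-- The orthogonal projection `P_k` of `X` onto `X_k`. -/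
def proj (α : AglerColligation N U) (k : Fin N) : α.X →L[ℂ] α.X := (α.part k).starProjection

/-- The transfer function `D + C P(w) (I - A P(w))⁻¹ B`, `P(w) = ∑ w_k P_k`. -/
def transfer (α : AglerColligation N U) (w : Fin N → ℂ) : U →L[ℂ] U :=
  block₂₂ α.op + block₂₁ α.op ∘L pencil α.proj w ∘L
    Ring.inverse (1 - block₁₁ α.op ∘L pencil α.proj w) ∘L block₁₂ α.op

end AglerColligation

/-- The Cayley transform over the variables, `F(w) = f((1 + w₁)/(1 - w₁), …)`. -/
def cayleyVar (f : (Fin N → ℂ) → U →L[ℂ] U) (w : Fin N → ℂ) : U →L[ℂ] U :=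
  f fun k => (1 + w k) / (1 - w k)

/-- `𝓕 = (F - I)(F + I)⁻¹` on `𝔻^N`, i.e. the double Cayley transform of `f` is well defined and
equals `𝓕`. -/
def IsDoubleCayley (f 𝓕 : (Fin N → ℂ) → U →L[ℂ] U) : Prop :=
  ∀ w ∈ polyDisk N, IsUnit (cayleyVar f w + 1) ∧
    𝓕 w = (cayleyVar f w - 1) * Ring.inverse (cayleyVar f w + 1)

end Agler

end

end Bessmertnyi

namespace Bessmertnyi

noncomputable section

/-! ### Anti-unitary involutions -/

namespace IsAUI

variable {U : Type*} [NormedAddCommGroup U] [InnerProductSpace ℂ U] {ι : U → U}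

/-! Everything passes through one object: a factorization f(z) = h(ζ)* P(z) h(z), where P(z) = ∑ z_k
P_k and the result does not depend on ζ.

From a long resolvent to kernels: the column S(z) = [I; -d(z)⁻¹c(z)] satisfies A(z) S(z) = [f(z);
0], so the kernels Φ_k(z, ζ) = S(ζ)* A_k S(z) satisfy ∑ z_k Φ_k(z, ζ) = f(z). When f is real,
averaging Φ_k with ι Φ_k(z̄, ζ̄) ι makes the kernels real (`exists_real_kernels`).

From kernels to a factorization: a Kolmogorov decomposition of the block diagonal kernel provides h
(`nonempty_realFactorization`). Reality of the kernels says that conjugating the index conjugates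
the Gram matrix, hence is implemented by an anti-unitary involution (`exists_isAUI_of_total`).

From a factorization to a long resolvent: independence of ζ makes P(z)h(z)u orthogonal to K, the
closed span of all (h(ζ) - h(1))v. With W(u, x) = h(1)u + x on U ⊕ K, the pencil W* P(z) W has Schur
complement f on Π^N (`schur_pencil_eq`); homogeneity and the identity theorem carry this to Ω_N.

From a factorization to a colligation: the vectors (P(z)h(z)u, f(z)u) are orthogonal to all vectors
(-h(ζ)v, v). The reflection in the closed span of the first family fixes the former and negates the
latter, and on sums of two such vectors this is exactly the double Cayley transform
(`isDoubleCayley`). Conversely, orthogonality of the eigenspaces for 1 and -1 of a selfadjoint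
unitary gives back a factorization (`inner_aglerFactor`).

Reality is carried along by relations κ S = T ι, with S and T typically the values at z and z̄;
sums, products, adjoints and inverses preserve such relations. -/

theorem inner_left (h : IsAUI ι) (x y : U) : inner ℂ (ι x) y = inner ℂ (ι y) x := by
  simpa only [h.involutive] using h.inner_map x (ι y)

theorem inner_right (h : IsAUI ι) (x y : U) : inner ℂ x (ι y) = inner ℂ y (ι x) := by
  simpa only [h.involutive] using h.inner_map (ι x) y

/-- Conjugate-linearity is not an axiom: the inner product identity moves `ι` to the other vector,
where linearity of the inner product applies. -/
theorem map_add (h : IsAUI ι) (x y : U) : ι (x + y) = ι x + ι y := by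
  refine ext_inner_right ℂ fun w => ?_
  rw [inner_add_left, h.inner_left, h.inner_left x, h.inner_left y, inner_add_right]

theorem map_smul (h : IsAUI ι) (c : ℂ) (x : U) : ι (c • x) = star c • ι x := by
  refine ext_inner_right ℂ fun w => ?_
  rw [inner_smul_left, h.inner_left, h.inner_left x, inner_smul_right]
  simp

theorem norm_map (h : IsAUI ι) (x : U) : ‖ι x‖ = ‖x‖ := by
  rw [@norm_eq_sqrt_re_inner ℂ, @norm_eq_sqrt_re_inner ℂ _ _ _ _ x, h.inner_map]

/-- An anti-unitary involution as a conjugate-linear isometry. -/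
def toLinearIsometry (h : IsAUI ι) : U →ₗᵢ⋆[ℂ] U where
  toFun := ι
  map_add' := h.map_add
  map_smul' := h.map_smul
  norm_map' := h.norm_map

@[simp]
theorem toLinearIsometry_apply (h : IsAUI ι) (x : U) : h.toLinearIsometry x = ι x := rfl

theorem map_zero (h : IsAUI ι) : ι 0 = 0 := h.toLinearIsometry.map_zero

theorem map_sub (h : IsAUI ι) (x y : U) : ι (x - y) = ι x - ι y := h.toLinearIsometry.map_sub x y

theorem map_sum (h : IsAUI ι) {J : Type*} (s : Finset J) (x : J → U) :
    ι (∑ j ∈ s, x j) = ∑ j ∈ s, ι (x j) := _root_.map_sum h.toLinearIsometry x s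

theorem continuous (h : IsAUI ι) : Continuous ι := h.toLinearIsometry.continuous

/-- A map which permutes a family of vectors maps the closed span of the family into itself. -/
theorem mem_closure_span (h : IsAUI ι) {s : Set U} (hs : ∀ x ∈ s, ι x ∈ s) {x : U}
    (hx : x ∈ (Submodule.span ℂ s).topologicalClosure) :
    ι x ∈ (Submodule.span ℂ s).topologicalClosure := by
  refine map_mem_closure h.continuous hx fun y hy => ?_
  refine Submodule.span_induction (p := fun y _ => ι y ∈ Submodule.span ℂ s) ?_ ?_ ?_ ?_ hy
  · exact fun y hy => Submodule.subset_span (hs y hy)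
  · rw [h.map_zero]; exact Submodule.zero_mem _
  · intro x y _ _ hx hy
    rw [h.map_add]; exact Submodule.add_mem _ hx hy
  · intro c x _ hx
    rw [h.map_smul]; exact Submodule.smul_mem _ _ hx

theorem mem_orthogonal (h : IsAUI ι) {K : Submodule ℂ U} (hK : ∀ x ∈ K, ι x ∈ K) {x : U}
    (hx : x ∈ Kᗮ) : ι x ∈ Kᗮ := by
  intro y hy
  rw [← h.involutive y, h.inner_map, ← inner_conj_symm, hx _ (hK y hy), _root_.map_zero]

/-- Invariance of `K` passes to `Kᗮ`, so `ι` carries the orthogonal decomposition of `x` to that of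
`ι x`. -/
theorem starProjection_map (h : IsAUI ι) {K : Submodule ℂ U} [K.HasOrthogonalProjection]
    (hK : ∀ x ∈ K, ι x ∈ K) (x : U) : ι (K.starProjection x) = K.starProjection (ι x) := by
  refine (Submodule.eq_starProjection_of_mem_of_inner_eq_zero (hK _ (by simp)) fun w hw => ?_).symm
  rw [← h.map_sub]
  exact (Submodule.mem_orthogonal' _ _).1
    (h.mem_orthogonal hK (K.sub_starProjection_mem_orthogonal x)) w hw

/-- An anti-unitary involution restricts to every closed subspace it maps into itself. -/
theorem restrict (h : IsAUI ι) {K : Submodule ℂ U} (hK : ∀ x ∈ K, ι x ∈ K) :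
    IsAUI fun x : K => (⟨ι x, hK x x.2⟩ : K) where
  involutive x := Subtype.ext (h.involutive x)
  inner_map x y := h.inner_map x y

theorem sumMap {V : Type*} [NormedAddCommGroup V] [InnerProductSpace ℂ V] {κ : V → V}
    (h : IsAUI ι) (hκ : IsAUI κ) : IsAUI (sumMap ι κ) where
  involutive x := by
    exact congrArg (WithLp.toLp 2) (Prod.ext (h.involutive x.fst) (hκ.involutive x.snd))
  inner_map x y := by
    simp [Bessmertnyi.sumMap, WithLp.prod_inner_apply, h.inner_map, hκ.inner_map]

end IsAUI

/-- An involution of the index set of a total family which conjugates the Gram matrix of the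
family is induced by an anti-unitary involution. -/
theorem exists_isAUI_of_total {K : Type*} [NormedAddCommGroup K] [InnerProductSpace ℂ K]
    [CompleteSpace K] {J : Type*} (v : J → K) (σ : J → J)
    (hv : (Submodule.span ℂ (Set.range v)).topologicalClosure = ⊤)
    (hσ : ∀ i, σ (σ i) = i) (hinner : ∀ i j, inner ℂ (v (σ i)) (v (σ j)) = inner ℂ (v j) (v i)) :
    ∃ κ : K → K, IsAUI κ ∧ ∀ i, κ (v i) = v (σ i) := by
  classical
  let e : (J →₀ ℂ) →ₗ[ℂ] K := Finsupp.linearCombination ℂ v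
  let g : (J →₀ ℂ) →ₗ⋆[ℂ] K :=
    { toFun := fun c => c.sum fun i a => star a • v (σ i)
      map_add' := fun c d => by
        rw [Finsupp.sum_add_index'] <;> simp [add_smul]
      map_smul' := fun a c => by
        rw [Finsupp.sum_smul_index] <;> simp [Finsupp.smul_sum, smul_smul] }
  have hg (c d : J →₀ ℂ) : inner ℂ (g c) (g d) = inner ℂ (e d) (e c) := by
    simp only [g, e, LinearMap.coe_mk, AddHom.coe_mk, Finsupp.linearCombination_apply,
      Finsupp.sum_inner, Finsupp.inner_sum, inner_smul_left, inner_smul_right, hinner]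
    simp only [Finsupp.sum, Finset.mul_sum]
    rw [Finset.sum_comm]
    refine Finset.sum_congr rfl fun i _ => Finset.sum_congr rfl fun j _ => ?_
    simp only [RCLike.star_def, RCLike.conj_conj]
    ring
  -- The Gram identity makes `g` isometric relative to `e`, so `g` factors through `e` and extends
  -- continuously from its dense range.
  have hn (c) : ‖g c‖ ≤ 1 * ‖e c‖ := by
    rw [@norm_eq_sqrt_re_inner ℂ, @norm_eq_sqrt_re_inner ℂ _ _ _ _ (e c), hg, one_mul]
  have he : DenseRange e := by
    rw [DenseRange, ← LinearMap.coe_range, Finsupp.range_linearCombination]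
    exact Submodule.dense_iff_topologicalClosure_eq_top.2 hv
  let κ : K →L⋆[ℂ] K := g.extendOfNorm e
  have hκ (c) : κ (e c) = g c := LinearMap.extendOfNorm_eq he ⟨1, hn⟩ c
  have hκv (i : J) : κ (v i) = v (σ i) := by
    simpa [e, g] using hκ (Finsupp.single i 1)
  refine ⟨κ, ⟨fun x => ?_, fun x y => ?_⟩, hκv⟩
  · refine congrFun (he.equalizer (κ.continuous.comp κ.continuous) continuous_id ?_) x
    funext c
    simp only [Function.comp_apply, id]
    rw [hκ]
    simp [g, e, Finsupp.linearCombination_apply, map_finsuppSum, hκv, hσ]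
  · refine he.induction_on₂ (p := fun x y => inner ℂ (κ x) (κ y) = inner ℂ y x) ?_ ?_ x y
    · exact isClosed_eq (by fun_prop) (by fun_prop)
    · intro c d
      rw [hκ, hκ, hg]

/-! ### Intertwining relations -/

/-- `κ S = T ι`. -/
def Intertwines {G K : Type*} [NormedAddCommGroup G] [InnerProductSpace ℂ G]
    [NormedAddCommGroup K] [InnerProductSpace ℂ K] (ι : G → G) (κ : K → K)
    (S T : G →L[ℂ] K) : Prop :=
  ∀ x, κ (S x) = T (ι x)

namespace Intertwines

variable {G K V : Type*} [NormedAddCommGroup G] [InnerProductSpace ℂ G]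
  [NormedAddCommGroup K] [InnerProductSpace ℂ K] [NormedAddCommGroup V] [InnerProductSpace ℂ V]
  {ι : G → G} {κ : K → K} {τ : V → V} {S T S' T' : G →L[ℂ] K}

theorem comp {Q R : K →L[ℂ] V} (h : Intertwines κ τ Q R) (h' : Intertwines ι κ S T) :
    Intertwines ι τ (Q ∘L S) (R ∘L T) := fun x => by
  rw [ContinuousLinearMap.comp_apply, h, h']; rfl

theorem one : Intertwines ι ι 1 1 := fun _ => rfl

theorem symm (hι : IsAUI ι) (hκ : IsAUI κ) (h : Intertwines ι κ S T) : Intertwines ι κ T S :=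
  fun x => by rw [← hκ.involutive (S (ι x)), h, hι.involutive]

theorem add (hκ : IsAUI κ) (h : Intertwines ι κ S T) (h' : Intertwines ι κ S' T') :
    Intertwines ι κ (S + S') (T + T') := fun x => by
  simp only [add_apply, hκ.map_add, h x, h' x]

theorem sub (hκ : IsAUI κ) (h : Intertwines ι κ S T) (h' : Intertwines ι κ S' T') :
    Intertwines ι κ (S - S') (T - T') := fun x => by
  simp only [sub_apply, hκ.map_sub, h x, h' x]

theorem smul (hκ : IsAUI κ) (h : Intertwines ι κ S T) (c : ℂ) :
    Intertwines ι κ (c • S) (star c • T) := fun x => by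
  simp only [smul_apply, hκ.map_smul, h x]

theorem adjoint [CompleteSpace G] [CompleteSpace K] (hι : IsAUI ι) (hκ : IsAUI κ)
    (h : Intertwines ι κ S T) :
    Intertwines κ ι (ContinuousLinearMap.adjoint S) (ContinuousLinearMap.adjoint T) := fun x => by
  refine ext_inner_right ℂ fun y => ?_
  rw [hι.inner_left, ContinuousLinearMap.adjoint_inner_right, ContinuousLinearMap.adjoint_inner_left,
    hκ.inner_left, symm hι hκ h]

theorem ringInverse {S T : G →L[ℂ] G} (h : Intertwines ι ι S T) (hS : IsUnit S) (hT : IsUnit T) :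
    Intertwines ι ι (Ring.inverse S) (Ring.inverse T) := fun x => by
  have h1 : S (Ring.inverse S x) = x := congr($(Ring.mul_inverse_cancel S hS) x)
  have h2 (y) : Ring.inverse T (T y) = y := congr($(Ring.inverse_mul_cancel T hT) y)
  rw [← h2 (ι _), ← h, h1]

theorem pencil {N : ℕ} {A : Fin N → G →L[ℂ] G} (hι : IsAUI ι) (hA : ∀ k, IsRealOp ι (A k))
    (z : Fin N → ℂ) : Intertwines ι ι (pencil A z) (Bessmertnyi.pencil A (star z)) := fun x => by
  simp only [Bessmertnyi.pencil, sum_apply, smul_apply,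
    hι.map_sum, hι.map_smul, hA _ x, Pi.star_apply]

end Intertwines

section Blocks

variable {G K : Type*} [NormedAddCommGroup G] [InnerProductSpace ℂ G]
  [NormedAddCommGroup K] [InnerProductSpace ℂ K] {ι : G → G} {κ : K → K}

theorem intertwines_inl (hκ : IsAUI κ) : Intertwines ι (sumMap ι κ) (inl G K) (inl G K) :=
  fun _ => congrArg (WithLp.toLp 2) (Prod.ext rfl hκ.map_zero)

theorem intertwines_inr (hι : IsAUI ι) : Intertwines κ (sumMap ι κ) (inr G K) (inr G K) :=
  fun _ => congrArg (WithLp.toLp 2) (Prod.ext hι.map_zero rfl)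

theorem intertwines_fst :
    Intertwines (sumMap ι κ) ι (WithLp.fstL 2 ℂ G K) (WithLp.fstL 2 ℂ G K) := fun _ => rfl

theorem intertwines_snd :
    Intertwines (sumMap ι κ) κ (WithLp.sndL 2 ℂ G K) (WithLp.sndL 2 ℂ G K) := fun _ => rfl

theorem apply_toLp (A : WithLp 2 (G × K) →L[ℂ] WithLp 2 (G × K)) (x : G) (y : K) :
    A (WithLp.toLp 2 (x, y)) =
      WithLp.toLp 2 (block₁₁ A x + block₁₂ A y, block₂₁ A x + block₂₂ A y) := by
  have : WithLp.toLp 2 (x, y) = inl G K x + inr G K y := by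
    simp [inl, inr, ← WithLp.toLp_add]
  rw [this, map_add]
  rfl

variable {A B : WithLp 2 (G × K) →L[ℂ] WithLp 2 (G × K)}

theorem intertwines_block₁₁ (hκ : IsAUI κ) (h : Intertwines (sumMap ι κ) (sumMap ι κ) A B) :
    Intertwines ι ι (block₁₁ A) (block₁₁ B) := intertwines_fst.comp (h.comp (intertwines_inl hκ))

theorem intertwines_block₁₂ (hι : IsAUI ι) (h : Intertwines (sumMap ι κ) (sumMap ι κ) A B) :
    Intertwines κ ι (block₁₂ A) (block₁₂ B) := intertwines_fst.comp (h.comp (intertwines_inr hι))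

theorem intertwines_block₂₁ (hκ : IsAUI κ) (h : Intertwines (sumMap ι κ) (sumMap ι κ) A B) :
    Intertwines ι κ (block₂₁ A) (block₂₁ B) := intertwines_snd.comp (h.comp (intertwines_inl hκ))

theorem intertwines_block₂₂ (hι : IsAUI ι) (h : Intertwines (sumMap ι κ) (sumMap ι κ) A B) :
    Intertwines κ κ (block₂₂ A) (block₂₂ B) := intertwines_snd.comp (h.comp (intertwines_inr hι))

end Blocks

theorem isRealFun_iff {E U : Type*} [Star E] [NormedAddCommGroup U] [InnerProductSpace ℂ U]
    {ι : U → U} (hι : IsAUI ι) {Ω : Set E} {f : E → U →L[ℂ] U} :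
    IsRealFun ι Ω f ↔ ∀ z ∈ Ω, Intertwines ι ι (f (star z)) (f z) := by
  refine ⟨fun h z hz x => ?_, fun h z hz x => ?_⟩
  · rw [← h z hz, hι.involutive]
  · rw [h z hz, hι.involutive]

/-! ### Holomorphic kernels -/

/-- The composition of a holomorphic map with two conjugate-linear ones is holomorphic. -/
theorem differentiableOn_conj_comp_conj {E E' F F' : Type*} [NormedAddCommGroup E]
    [NormedSpace ℂ E] [NormedAddCommGroup E'] [NormedSpace ℂ E'] [NormedAddCommGroup F]
    [NormedSpace ℂ F] [NormedAddCommGroup F'] [NormedSpace ℂ F'] (L : E →L⋆[ℂ] E')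
    (C : F →L⋆[ℂ] F') {g : E' → F} {s : Set E} {t : Set E'} (hg : DifferentiableOn ℂ g t)
    (hst : ∀ z ∈ s, L z ∈ t) : DifferentiableOn ℂ (fun z => C (g (L z))) s := by
  intro z hz
  obtain ⟨g', hg'⟩ := hg (L z) (hst z hz)
  -- Two conjugate-linear factors around `g'` compose to a complex-linear derivative.
  refine ⟨C.comp (g'.comp L), .of_isLittleO ?_⟩
  have hL : Filter.Tendsto L (nhdsWithin z s) (nhdsWithin (L z) t) :=
    L.continuous.continuousWithinAt.tendsto_nhdsWithin hst
  have h1 := (hg'.isLittleO.comp_tendsto hL).trans_isBigO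
    (k := fun y => y - z) (Asymptotics.IsBigO.of_bound ‖L‖ (.of_forall fun y => by
      simpa only [Function.comp_apply, ← map_sub] using L.le_opNorm _))
  refine Asymptotics.IsBigO.trans_isLittleO
    (Asymptotics.IsBigO.of_bound ‖C‖ (.of_forall fun y => ?_)) h1
  refine le_of_eq_of_le ?_ (C.le_opNorm _)
  simp

/-- Coordinatewise complex conjugation. -/
def conjVec (N : ℕ) : (Fin N → ℂ) →L⋆[ℂ] (Fin N → ℂ) where
  toFun := star
  map_add' := star_add
  map_smul' c z := by simp [star_smul]
  cont := continuous_star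

/-- The adjoint, as a conjugate-linear map. -/
def adjointCLM (U : Type*) [NormedAddCommGroup U] [InnerProductSpace ℂ U] [CompleteSpace U] :
    (U →L[ℂ] U) →L⋆[ℂ] (U →L[ℂ] U) where
  toFun := ContinuousLinearMap.adjoint
  map_add' := map_add _
  map_smul' := map_smulₛₗ _
  cont := ContinuousLinearMap.adjoint.continuous

/-- The operator `ι T ι`, as a function of `T`. -/
def conjOp {U : Type*} [NormedAddCommGroup U] [InnerProductSpace ℂ U]
    {ι : U → U} (hι : IsAUI ι) : (U →L[ℂ] U) →L⋆[ℂ] (U →L[ℂ] U) :=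
  LinearMap.mkContinuous
    { toFun := fun T => hι.toLinearIsometry.toContinuousLinearMap.comp
        (T.comp hι.toLinearIsometry.toContinuousLinearMap)
      map_add' := fun S T => by ext x; simp
      map_smul' := fun c T => by ext x; simp } 1 fun T => by
    refine ContinuousLinearMap.opNorm_le_bound _ (by positivity) fun x => ?_
    simpa [hι.norm_map] using T.le_opNorm (ι x)

theorem conjOp_apply {U : Type*} [NormedAddCommGroup U] [InnerProductSpace ℂ U]
    {ι : U → U} (hι : IsAUI ι) (T : U →L[ℂ] U) (x : U) :
    conjOp hι T x = ι (T (ι x)) := rfl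

theorem intertwines_conjOp {U : Type*} [NormedAddCommGroup U] [InnerProductSpace ℂ U]
    {ι : U → U} (hι : IsAUI ι) (T : U →L[ℂ] U) :
    Intertwines ι ι T (conjOp hι T) := fun x => by rw [conjOp_apply, hι.involutive]

theorem intertwines_iff_conjOp {U : Type*} [NormedAddCommGroup U] [InnerProductSpace ℂ U]
    {ι : U → U} (hι : IsAUI ι) {S T : U →L[ℂ] U} :
    Intertwines ι ι S T ↔ conjOp hι S = T := by
  refine ⟨fun h => ?_, fun h => h ▸ intertwines_conjOp hι S⟩
  ext x
  rw [conjOp_apply, h, hι.involutive]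

section Kernels

variable {N : ℕ} {U : Type u} [NormedAddCommGroup U] [InnerProductSpace ℂ U] [CompleteSpace U]
  {Ω : Set (Fin N → ℂ)} {Φ Ψ : (Fin N → ℂ) → (Fin N → ℂ) → U →L[ℂ] U}

/-- A positive semidefinite kernel that is holomorphic in `z` is anti-holomorphic in `ζ`. -/
theorem IsHolomorphicPSDKernel.mk' (hherm : ∀ z ∈ Ω, ∀ ζ ∈ Ω, Φ z ζ =
      ContinuousLinearMap.adjoint (Φ ζ z))
    (hpos : ∀ (m : ℕ) (z : Fin m → Fin N → ℂ) (v : Fin m → U), (∀ μ, z μ ∈ Ω) →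
      0 ≤ ∑ μ, ∑ ν, inner ℂ (v ν) (Φ (z μ) (z ν) (v μ)))
    (hhol : ∀ ζ ∈ Ω, DifferentiableOn ℂ (fun z => Φ z ζ) Ω) : IsHolomorphicPSDKernel Ω Φ where
  hermitian := hherm
  nonneg := hpos
  holomorphic := hhol
  antiholomorphic z hz :=
    (differentiableOn_conj_comp_conj (conjVec N) (adjointCLM U) (s := {ζ | star ζ ∈ Ω})
      (hhol z hz) (fun _ => id)).congr fun _ hζ => hherm z hz _ hζ

theorem IsHolomorphicPSDKernel.add (h : IsHolomorphicPSDKernel Ω Φ)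
    (h' : IsHolomorphicPSDKernel Ω Ψ) : IsHolomorphicPSDKernel Ω fun z ζ => Φ z ζ + Ψ z ζ := by
  refine .mk' (fun z hz ζ hζ => ?_) (fun m z v hz => ?_) fun ζ hζ =>
    (h.holomorphic ζ hζ).add (h'.holomorphic ζ hζ)
  · rw [map_add, ← h.hermitian z hz ζ hζ, ← h'.hermitian z hz ζ hζ]
  · simp only [add_apply, inner_add_right, Finset.sum_add_distrib]
    exact add_nonneg (h.nonneg m z v hz) (h'.nonneg m z v hz)

theorem IsHolomorphicPSDKernel.smul (h : IsHolomorphicPSDKernel Ω Φ) {c : ℝ} (hc : 0 ≤ c) :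
    IsHolomorphicPSDKernel Ω fun z ζ => (c : ℂ) • Φ z ζ := by
  refine .mk' (fun z hz ζ hζ => ?_) (fun m z v hz => ?_) fun ζ hζ =>
    (h.holomorphic ζ hζ).const_smul (c : ℂ)
  · rw [map_smulₛₗ, ← h.hermitian z hz ζ hζ, Complex.conj_ofReal]
  · simp only [smul_apply, inner_smul_right, ← Finset.mul_sum]
    exact mul_nonneg (by exact_mod_cast hc) (h.nonneg m z v hz)

/-- The kernel `ι Φ(z̄, ζ̄) ι`. -/
theorem IsHolomorphicPSDKernel.conj (h : IsHolomorphicPSDKernel Ω Φ) {ι : U → U} (hι : IsAUI ι)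
    (hΩ : ∀ z ∈ Ω, star z ∈ Ω) :
    IsHolomorphicPSDKernel Ω fun z ζ => conjOp hι (Φ (star z) (star ζ)) := by
  refine .mk' (fun z hz ζ hζ => ?_) (fun m z v hz => ?_) fun ζ hζ =>
    differentiableOn_conj_comp_conj (conjVec N) (conjOp hι) (h.holomorphic (star ζ) (hΩ _ hζ))
      hΩ
  · refine (intertwines_iff_conjOp hι).1 ?_
    rw [h.hermitian _ (hΩ _ hz) _ (hΩ _ hζ)]
    exact (intertwines_conjOp hι _).adjoint hι hι
  -- The sum for the new kernel is the complex conjugate of the old sum at the points z̄ and the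
  -- vectors ι v.
  · have h1 := h.nonneg m (fun μ => star (z μ)) (fun μ => ι (v μ)) fun μ => hΩ _ (hz μ)
    rw [← star_nonneg_iff] at h1
    refine h1.trans_eq ?_
    simp only [star_sum]
    refine Finset.sum_congr rfl fun μ _ => Finset.sum_congr rfl fun ν _ => ?_
    rw [conjOp_apply, RCLike.star_def, inner_conj_symm, hι.inner_right]

/-- The kernel `G(ζ)* A G(z)`. -/
theorem isHolomorphicPSDKernel_factor {V : Type*} [NormedAddCommGroup V] [InnerProductSpace ℂ V]
    [CompleteSpace V] {A : V →L[ℂ] V} (hA : A.IsPositive) {G : (Fin N → ℂ) → U →L[ℂ] V}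
    (hG : DifferentiableOn ℂ G Ω) : IsHolomorphicPSDKernel Ω fun z ζ =>
      ContinuousLinearMap.adjoint (G ζ) ∘L A ∘L G z := by
  refine .mk' (fun z hz ζ hζ => ?_) (fun m z v hz => ?_) fun ζ hζ => ?_
  · simp only [ContinuousLinearMap.adjoint_comp, ContinuousLinearMap.adjoint_adjoint,
      hA.isSelfAdjoint.adjoint_eq, ContinuousLinearMap.comp_assoc]
  -- The double sum is the quadratic form of `A` at the single vector ∑ G(z_μ) v_μ.
  · refine (hA.inner_nonneg_right (∑ μ, G (z μ) (v μ))).trans_eq ?_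
    simp only [map_sum, sum_inner, inner_sum, ContinuousLinearMap.comp_apply,
      ContinuousLinearMap.adjoint_inner_right]
  · exact (differentiableOn_const _).clm_comp ((differentiableOn_const _).clm_comp hG)

end Kernels

/-! ### Domains -/

section Domains

variable {N : ℕ}

theorem star_mem_polyHalfPlane {z : Fin N → ℂ} (hz : z ∈ polyHalfPlane N) :
    star z ∈ polyHalfPlane N := fun k => by simpa using hz k

theorem polyHalfPlane_subset_Omega : polyHalfPlane N ⊆ Omega N :=
  fun z hz => ⟨1, by simp, z, hz, by simp⟩

theorem star_mem_Omega {z : Fin N → ℂ} (hz : z ∈ Omega N) : star z ∈ Omega N := by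
  obtain ⟨l, hl, w, hw, rfl⟩ := hz
  exact ⟨star l, by simpa using hl, star w, star_mem_polyHalfPlane hw, by simp [star_smul]⟩

theorem one_mem_polyHalfPlane : (1 : Fin N → ℂ) ∈ polyHalfPlane N := fun k => by simp

theorem isOpen_polyHalfPlane : IsOpen (polyHalfPlane N) := by
  simp only [polyHalfPlane, Set.ofPred_forall]
  exact isOpen_iInter_of_finite fun k =>
    isOpen_lt continuous_const (Complex.continuous_re.comp (continuous_apply k))

theorem smul_mem_Omega {μ : ℂ} (hμ : μ ≠ 0) {w : Fin N → ℂ} (hw : w ∈ polyHalfPlane N) :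
    μ • w ∈ Omega N := by
  have h0 : 0 < ‖μ‖ := norm_pos_iff.2 hμ
  refine ⟨μ / ‖μ‖, by simp [h0.ne'], (‖μ‖ : ℂ) • w, fun k => ?_, ?_⟩
  · simpa using mul_pos h0 (hw k)
  · rw [smul_smul, div_mul_cancel₀]
    exact_mod_cast h0.ne'

/-- A holomorphic function on `Ω_N` which is homogeneous on `Π^N` is homogeneous. -/
theorem apply_smul_of_homogeneous {F : Type*} [NormedAddCommGroup F] [NormedSpace ℂ F]
    [CompleteSpace F] {f : (Fin N → ℂ) → F} (hf : DifferentiableOn ℂ f (Omega N))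
    (hh : ∀ z ∈ polyHalfPlane N, ∀ μ : ℂ, μ • z ∈ polyHalfPlane N → f (μ • z) = μ • f z)
    {z : Fin N → ℂ} (hz : z ∈ polyHalfPlane N) {μ : ℂ} (hμ : μ ≠ 0) : f (μ • z) = μ • f z := by
  -- The whole punctured line through `z` lies in Ω_N and the punctured plane is connected, so the
  -- identity theorem spreads homogeneity from μ near 1 to every nonzero μ.
  have ho : IsOpen ({0}ᶜ : Set ℂ) := isOpen_compl_singleton
  have h1 : AnalyticOnNhd ℂ (fun μ : ℂ => f (μ • z)) {0}ᶜ := by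
    refine DifferentiableOn.analyticOnNhd (hf.comp ?_ fun ν hν => smul_mem_Omega hν hz) ho
    fun_prop
  have h2 : AnalyticOnNhd ℂ (fun μ : ℂ => μ • f z) {0}ᶜ := by
    refine DifferentiableOn.analyticOnNhd ?_ ho
    fun_prop
  have hc : IsPreconnected ({0}ᶜ : Set ℂ) :=
    (isConnected_compl_singleton_of_one_lt_rank (by simp) 0).isPreconnected
  refine h1.eqOn_of_preconnected_of_eventuallyEq h2 hc (z₀ := 1) (by simp) ?_ hμ
  have : ∀ᶠ ν : ℂ in nhds 1, ν • z ∈ polyHalfPlane N :=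
    (isOpen_polyHalfPlane.preimage (f := fun ν : ℂ => ν • z) (by fun_prop)).mem_nhds
      (by simpa using hz)
  filter_upwards [this] with ν hν using hh z hz ν hν

end Domains

/-! ### Schur complements -/

section Schur

variable {G K : Type*} [NormedAddCommGroup G] [InnerProductSpace ℂ G]
  [NormedAddCommGroup K] [InnerProductSpace ℂ K]

/-- The Schur complement `a - b d⁻¹ c`. -/
def schur (A : WithLp 2 (G × K) →L[ℂ] WithLp 2 (G × K)) : G →L[ℂ] G :=
  block₁₁ A - block₁₂ A ∘L Ring.inverse (block₂₂ A) ∘L block₂₁ A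

/-- The column `[I; - d⁻¹ c]`. -/
def schurColumn (A : WithLp 2 (G × K) →L[ℂ] WithLp 2 (G × K)) : G →L[ℂ] WithLp 2 (G × K) :=
  inl G K - inr G K ∘L Ring.inverse (block₂₂ A) ∘L block₂₁ A

variable {A : WithLp 2 (G × K) →L[ℂ] WithLp 2 (G × K)}

theorem schurColumn_apply (x : G) :
    schurColumn A x = WithLp.toLp 2 (x, -Ring.inverse (block₂₂ A) (block₂₁ A x)) := by
  simp [schurColumn, inl, inr, ← WithLp.toLp_sub]

/-- The column is chosen to annihilate the second component; what remains in the first is the Schur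
complement. -/
theorem apply_schurColumn (hA : IsUnit (block₂₂ A)) (x : G) :
    A (schurColumn A x) = WithLp.toLp 2 (schur A x, 0) := by
  have h (y : K) : block₂₂ A (Ring.inverse (block₂₂ A) y) = y :=
    congr($(Ring.mul_inverse_cancel _ hA) y)
  rw [schurColumn_apply, apply_toLp]
  simp [schur, h, sub_eq_add_neg]

/-- Invertibility of the lower right block forces w = -d⁻¹c x. A Schur complement can thus be found
by exhibiting one suitable vector, without computing an inverse. -/
theorem schur_eq_of_apply (hA : IsUnit (block₂₂ A)) {x y : G} {w : K}
    (h : A (WithLp.toLp 2 (x, w)) = WithLp.toLp 2 (y, 0)) : schur A x = y := by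
  have hi (y : K) : Ring.inverse (block₂₂ A) (block₂₂ A y) = y :=
    congr($(Ring.inverse_mul_cancel _ hA) y)
  rw [apply_toLp] at h
  have h1 : block₁₁ A x + block₁₂ A w = y := congrArg WithLp.fst h
  have h2 : block₂₁ A x + block₂₂ A w = 0 := congrArg WithLp.snd h
  simp [← h1, schur, eq_neg_of_add_eq_zero_left h2, hi]

theorem schur_smul {c : ℂ} (hc : c ≠ 0) (hA : IsUnit (block₂₂ A)) :
    schur (c • A) = c • schur A := by
  have h2 : block₂₂ (c • A) = c • block₂₂ A := by ext; simp [block₂₂]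
  have hA' : IsUnit (block₂₂ (c • A)) := by
    rw [h2]; exact hA.smul (Units.mk0 c hc)
  ext x
  refine schur_eq_of_apply (w := -Ring.inverse (block₂₂ A) (block₂₁ A x)) hA' ?_
  rw [smul_apply, ← schurColumn_apply, apply_schurColumn hA, ← WithLp.toLp_smul]
  simp

theorem intertwines_schur {ι : G → G} {κ : K → K} (hι : IsAUI ι) (hκ : IsAUI κ)
    {B : WithLp 2 (G × K) →L[ℂ] WithLp 2 (G × K)} (hA : IsUnit (block₂₂ A))
    (hB : IsUnit (block₂₂ B)) (h : Intertwines (sumMap ι κ) (sumMap ι κ) A B) :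
    Intertwines ι ι (schur A) (schur B) :=
  (intertwines_block₁₁ hκ h).sub hι <| (intertwines_block₁₂ hι h).comp <|
    ((intertwines_block₂₂ hι h).ringInverse hA hB).comp (intertwines_block₂₁ hκ h)

theorem pencil_smul {N : ℕ} (A : Fin N → G →L[ℂ] G) (c : ℂ) (z : Fin N → ℂ) :
    pencil A (c • z) = c • pencil A z := by
  simp [pencil, Finset.smul_sum, smul_smul]

theorem differentiable_pencil {N : ℕ} (A : Fin N → G →L[ℂ] G) : Differentiable ℂ (pencil A) := by
  unfold pencil
  fun_prop

theorem differentiableOn_schurColumn [CompleteSpace K] {N : ℕ} {s : Set (Fin N → ℂ)}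
    {A : Fin N → WithLp 2 (G × K) →L[ℂ] WithLp 2 (G × K)}
    (hA : ∀ z ∈ s, IsUnit (block₂₂ (pencil A z))) :
    DifferentiableOn ℂ (fun z => schurColumn (pencil A z)) s := by
  have hp := (differentiable_pencil A).differentiableOn (s := s)
  have h21 : DifferentiableOn ℂ (fun z => block₂₁ (pencil A z)) s :=
    (differentiableOn_const (WithLp.sndL 2 ℂ G K)).clm_comp
      (hp.clm_comp (differentiableOn_const (inl G K)))
  have h22 : DifferentiableOn ℂ (fun z => block₂₂ (pencil A z)) s :=
    (differentiableOn_const (WithLp.sndL 2 ℂ G K)).clm_comp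
      (hp.clm_comp (differentiableOn_const (inr G K)))
  have hi : DifferentiableOn ℂ (fun z => Ring.inverse (block₂₂ (pencil A z))) s := fun z hz =>
    DifferentiableAt.comp_differentiableWithinAt (g := Ring.inverse)
      (f := fun z => block₂₂ (pencil A z)) z (differentiableAt_inverse (hA z hz)) (h22 z hz)
  exact DifferentiableOn.const_sub
    ((differentiableOn_const (inr G K)).clm_comp (hi.clm_comp h21)) (inl G K)

end Schur

/-! ### Factorization of real kernels -/

section Projections

variable {N : ℕ} {X : Type*} [NormedAddCommGroup X] [InnerProductSpace ℂ X] 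
  {part : Fin N → Submodule ℂ X} [∀ k, CompleteSpace (part k)]

theorem starProjection_apply_of_ne
    (h : OrthogonalFamily ℂ (fun k => part k) fun k => (part k).subtypeₗᵢ) {j k : Fin N}
    (hjk : j ≠ k) {x : X} (hx : x ∈ part k) : (part j).starProjection x = 0 :=
  (Submodule.starProjection_apply_eq_zero_iff _).2 (h.isOrtho hjk.symm hx)

theorem sum_starProjection [CompleteSpace X]
    (h : IsHilbertSum ℂ (fun k => part k) fun k => (part k).subtypeₗᵢ)
    (x : X) : ∑ k, (part k).starProjection x = x := by
  obtain ⟨w, rfl⟩ := h.linearIsometryEquiv.symm.surjective x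
  have h1 : HasSum (fun k => ((w k : part k) : X)) (h.linearIsometryEquiv.symm w) :=
    h.hasSum_linearIsometryEquiv_symm w
  rw [h1.unique (hasSum_fintype _)]
  exact h.OrthogonalFamily.sum_projection_of_mem_iSup _ (Submodule.sum_mem _ fun k _ =>
    Submodule.mem_iSup_of_mem k (w k).2)

end Projections

/-- A factorization `f(z) = h(ζ)* P(z) h(z)`, `P(z) = ∑ z_k P_k`, by a real function `h` with values
in a Hilbert space `X = ⊕ X_k` that carries an anti-unitary involution commuting with the
orthogonal projections `P_k` onto the summands. -/
structure RealFactorization {N : ℕ} {U : Type u} [NormedAddCommGroup U] [InnerProductSpace ℂ U]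
    [CompleteSpace U] (ι : U → U) (f : (Fin N → ℂ) → U →L[ℂ] U) where
  /-- the auxiliary space -/
  X : Type u
  [normedAddCommGroup : NormedAddCommGroup X]
  [innerProductSpace : InnerProductSpace ℂ X]
  [completeSpace : CompleteSpace X]
  /-- the summands of the auxiliary space -/
  part : Fin N → Submodule ℂ X
  [completePart : ∀ k, CompleteSpace (part k)]
  isHilbertSum : IsHilbertSum ℂ (fun k => part k) (fun k => (part k).subtypeₗᵢ)
  /-- the anti-unitary involution -/
  conj : X → X
  isAUI : IsAUI conj
  real : ∀ k, IsRealOp conj (part k).starProjection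
  /-- the factor -/
  h : (Fin N → ℂ) → U →L[ℂ] X
  intertwines : ∀ z ∈ polyHalfPlane N, Intertwines ι conj (h z) (h (star z))
  eq : ∀ z ∈ polyHalfPlane N, ∀ ζ ∈ polyHalfPlane N,
    f z = ContinuousLinearMap.adjoint (h ζ) ∘L pencil (fun k => (part k).starProjection) z ∘L h z

attribute [instance] RealFactorization.normedAddCommGroup RealFactorization.innerProductSpace
  RealFactorization.completeSpace RealFactorization.completePart

/-! ### Kolmogorov decomposition and the real factorization -/

section Kernel

variable {N : ℕ} {U : Type u} [NormedAddCommGroup U] [InnerProductSpace ℂ U] [CompleteSpace U]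
  {Ω : Set (Fin N → ℂ)} {Φ : Fin N → (Fin N → ℂ) → (Fin N → ℂ) → U →L[ℂ] U}

/-- The block diagonal kernel with blocks `Φ_k`, as an operator matrix. -/
def kernelMatrix (Ω : Set (Fin N → ℂ)) (Φ : Fin N → (Fin N → ℂ) → (Fin N → ℂ) → U →L[ℂ] U) :
    Matrix (Fin N × Ω) (Fin N × Ω) (U →L[ℂ] U) :=
  .of fun p q => if p.1 = q.1 then Φ p.1 q.2 p.2 else 0

theorem IsHolomorphicPSDKernel.sum_nonneg {Ψ : (Fin N → ℂ) → (Fin N → ℂ) → U →L[ℂ] U}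
    (h : IsHolomorphicPSDKernel Ω Ψ) (s : Finset Ω) (v : Ω → U) :
    0 ≤ ∑ x ∈ s, ∑ y ∈ s, inner ℂ (v y) (Ψ x y (v x)) := by
  let e := s.equivFin.symm
  have h1 := h.nonneg s.card (fun μ => (e μ : Ω)) (fun μ => v (e μ)) fun μ => (e μ : Ω).2
  refine h1.trans_eq ?_
  rw [← Finset.sum_coe_sort s, ← e.sum_comp]
  refine Finset.sum_congr rfl fun μ _ => ?_
  rw [← Finset.sum_coe_sort s, ← e.sum_comp]

/-- Entries with different block indices vanish, so the quadratic form splits into a sum over k of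
the forms of the Φ_k. -/
theorem posSemidef_kernelMatrix (hΦ : ∀ k, IsHolomorphicPSDKernel Ω (Φ k)) :
    (kernelMatrix Ω Φ).PosSemidef := by
  classical
  have htfae := (RKHS.posSemidef_tfae (K := kernelMatrix Ω Φ)).out 0 2
  refine htfae.2 ⟨?_, fun v => ?_⟩
  · ext1 p q
    simp only [Matrix.conjTranspose_apply, kernelMatrix, Matrix.of_apply]
    by_cases hpq : p.1 = q.1
    · rw [if_pos hpq, if_pos hpq.symm, ContinuousLinearMap.star_eq_adjoint, hpq]
      exact ((hΦ _).hermitian _ q.2.2 _ p.2.2).symm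
    · rw [if_neg hpq, if_neg (Ne.symm hpq), star_zero]
  · let s : Finset Ω := v.support.image Prod.snd
    have hsub : v.support ⊆ Finset.univ ×ˢ s := fun p hp => by
      simp only [Finset.mem_product, Finset.mem_univ, true_and, s]
      exact Finset.mem_image_of_mem _ hp
    -- Here the kernel value sits in the conjugate-linear slot, hence the conjugates of the sums in
    -- `IsHolomorphicPSDKernel`.
    have h1 : (v.sum fun x w => v.sum fun x' w' => inner ℂ (kernelMatrix Ω Φ x' x w) w') =
        ∑ k, star (∑ x ∈ s, ∑ y ∈ s, inner ℂ (v (k, y)) (Φ k x y (v (k, x)))) := by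
      rw [Finsupp.sum_of_support_subset v hsub _ (by simp), Finset.sum_product]
      refine Finset.sum_congr rfl fun k _ => ?_
      rw [star_sum]
      refine Finset.sum_congr rfl fun x _ => ?_
      rw [Finsupp.sum_of_support_subset v hsub _ (by simp), Finset.sum_product,
        Finset.sum_eq_single k, star_sum]
      · refine Finset.sum_congr rfl fun y _ => ?_
        simp [kernelMatrix]
      · intro l _ hl
        simp [kernelMatrix, hl]
      · simp
    rw [h1, map_sum]
    refine Finset.sum_nonneg fun k _ => ?_
    exact (RCLike.nonneg_iff.1 (star_nonneg_iff.2 ((hΦ k).sum_nonneg s fun x => v (k, x)))).1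

/-- The Kolmogorov decomposition of a positive semidefinite operator matrix. -/
theorem exists_kolmogorov {J : Type} {K : Matrix J J (U →L[ℂ] U)} (hK : K.PosSemidef) :
    ∃ (X : Type u) (_ : NormedAddCommGroup X) (_ : InnerProductSpace ℂ X) (_ : CompleteSpace X)
      (H : J → U →L[ℂ] X),
      (∀ p q v w, inner ℂ (H p v) (H q w) = inner ℂ (K q p v) w) ∧
      (Submodule.span ℂ (Set.range fun i : J × U => H i.1 i.2)).topologicalClosure = ⊤ := by
  have : Fact K.PosSemidef := ⟨hK⟩
  refine ⟨RKHS.OfKernel K, inferInstance, inferInstance, inferInstance,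
    RKHS.kerFun (RKHS.OfKernel K), fun p q v w => ?_, ?_⟩
  · rw [← RKHS.kernel_inner, RKHS.OfKernel.kernel_ofKernel]
  · rw [← RKHS.kerFun_dense (𝕜 := ℂ) (RKHS.OfKernel K)]
    congr 2
    ext x
    simp

/-- The decomposition gives H(l, ζ)* H(k, z) = δ_{kl} Φ_k(z, ζ). Ranges with different k are
orthogonal and span the summands X_k; for h(z) = ∑ H(k, z) the product h(ζ)* P(z) h(z) collapses to
∑ z_k Φ_k(z, ζ). -/
theorem nonempty_realFactorization {ι : U → U} (hι : IsAUI ι) {f : (Fin N → ℂ) → U →L[ℂ] U}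
    (hΦ : ∀ k, IsHolomorphicPSDKernel (polyHalfPlane N) (Φ k))
    (hf : ∀ z ∈ polyHalfPlane N, ∀ ζ ∈ polyHalfPlane N, f z = ∑ k, z k • Φ k z ζ)
    (hreal : ∀ k, IsRealFun ι (polyHalfPlane N ×ˢ polyHalfPlane N) fun p => Φ k p.1 p.2) :
    Nonempty (RealFactorization ι f) := by
  classical
  let D := polyHalfPlane N
  obtain ⟨X, _, _, _, H, hin, hdense⟩ := exists_kolmogorov (posSemidef_kernelMatrix hΦ)
  -- The involution to be implemented on X: H(k, z)u ↦ H(k, z̄)ιu.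
  let σ : (Fin N × D) × U → (Fin N × D) × U := fun i =>
    ((i.1.1, ⟨star i.1.2.1, star_mem_polyHalfPlane i.1.2.2⟩), ι i.2)
  have hker (p q : Fin N × D) (i j : U) : Intertwines ι ι (kernelMatrix D Φ p q)
      (kernelMatrix D Φ (σ (p, i)).1 (σ (q, j)).1) := by
    intro x
    simp only [kernelMatrix, Matrix.of_apply, σ]
    by_cases hpq : p.1 = q.1
    · rw [if_pos hpq, if_pos hpq]
      have := (isRealFun_iff hι).1 (hreal p.1) (star (q.2 : Fin N → ℂ), star (p.2 : Fin N → ℂ))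
        ⟨star_mem_polyHalfPlane q.2.2, star_mem_polyHalfPlane p.2.2⟩ x
      simpa using this
    · rw [if_neg hpq, if_neg hpq]
      exact hι.map_zero
  obtain ⟨κ, hκ, hκH⟩ := exists_isAUI_of_total (fun i : (Fin N × D) × U => H i.1 i.2) σ
    hdense (fun i => by simp [σ, hι.involutive])
    (fun i j => by
      rw [hin, ← hker j.1 i.1 j.2 i.2, hι.inner_map, ← inner_conj_symm, ← hin, inner_conj_symm])
  let S : Fin N → Set X := fun k => Set.range fun i : D × U => H (k, i.1) i.2
  let part : Fin N → Submodule ℂ X := fun k => (Submodule.span ℂ (S k)).topologicalClosure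
  have hpart (k) : CompleteSpace (part k) :=
    (Submodule.isClosed_topologicalClosure _).completeSpace_coe
  have hmem (k : Fin N) (z : D) (u : U) : H (k, z) u ∈ part k :=
    Submodule.le_topologicalClosure _ (Submodule.subset_span ⟨(z, u), rfl⟩)
  have hsum : IsHilbertSum ℂ (fun k => part k) (fun k => (part k).subtypeₗᵢ) := by
    refine IsHilbertSum.mkInternal (F := part) ?_ ?_
    · refine OrthogonalFamily.of_pairwise fun j k hjk => ?_
      rw [Function.onFun, Submodule.IsOrtho, Submodule.orthogonal_closure]
      refine Submodule.topologicalClosure_minimal _ (Submodule.isOrtho_span.2 ?_)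
        (Submodule.isClosed_orthogonal _)
      rintro _ ⟨⟨z, u⟩, rfl⟩ _ ⟨⟨w, v⟩, rfl⟩
      simp [hin, kernelMatrix, hjk.symm]
    · rw [← hdense]
      refine Submodule.topologicalClosure_mono (Submodule.span_le.2 ?_)
      rintro _ ⟨⟨p, v⟩, rfl⟩
      exact Submodule.mem_iSup_of_mem p.1 (hmem p.1 p.2 v)
  have hP (j k : Fin N) (z : D) (u : U) :
      (part j).starProjection (H (k, z) u) = if j = k then H (k, z) u else 0 := by
    split_ifs with hjk
    · exact Submodule.starProjection_eq_self_iff.2 (hjk ▸ hmem k z u)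
    · exact starProjection_apply_of_ne hsum.OrthogonalFamily hjk (hmem k z u)
  refine ⟨{ X := X
            part := part
            isHilbertSum := hsum
            conj := κ
            isAUI := hκ
            real := fun k => hκ.starProjection_map fun x hx => hκ.mem_closure_span ?_ hx
            h := fun z => if hz : z ∈ D then ∑ k, H (k, ⟨z, hz⟩) else 0
            intertwines := ?_
            eq := ?_ }⟩
  · rintro _ ⟨⟨z, u⟩, rfl⟩
    exact ⟨(⟨star z.1, star_mem_polyHalfPlane z.2⟩, ι u), (hκH ((k, z), u)).symm⟩
  · intro z hz u
    rw [dif_pos (show z ∈ D from hz), dif_pos (show star z ∈ D from star_mem_polyHalfPlane hz)]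
    simp only [sum_apply, hκ.map_sum]
    exact Finset.sum_congr rfl fun k _ => hκH ((k, ⟨z, hz⟩), u)
  · intro z hz ζ hζ
    rw [dif_pos (show z ∈ D from hz), dif_pos (show ζ ∈ D from hζ)]
    ext u
    refine ext_inner_right ℂ fun v => ?_
    have hpen : pencil (fun k => (part k).starProjection) z (∑ k, H (k, ⟨z, hz⟩) u) =
        ∑ k, z k • H (k, ⟨z, hz⟩) u := by
      simp only [pencil, sum_apply, smul_apply, map_sum, hP]
      exact Finset.sum_congr rfl fun k _ => by simp
    rw [hf z hz ζ hζ, ContinuousLinearMap.comp_apply, ContinuousLinearMap.adjoint_inner_left,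
      ContinuousLinearMap.comp_apply, sum_apply, sum_apply, hpen, sum_inner, sum_apply, sum_inner]
    refine Finset.sum_congr rfl fun k _ => ?_
    rw [inner_sum, Finset.sum_eq_single k]
    · rw [inner_smul_left, hin, smul_apply, inner_smul_left]
      simp [kernelMatrix]
    · intro l _ hl
      rw [inner_smul_left, hin]
      simp [kernelMatrix, hl]
    · simp

end Kernel

/-! ### Pencils of projections -/

section Projections

variable {N : ℕ} {X : Type*} [NormedAddCommGroup X] [InnerProductSpace ℂ X]
  {part : Fin N → Submodule ℂ X} [∀ k, CompleteSpace (part k)]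

theorem inner_pencil (z : Fin N → ℂ) (x : X) :
    inner ℂ x (pencil (fun k => (part k).starProjection) z x) =
      ∑ k, z k * ((‖(part k).starProjection x‖ ^ 2 : ℝ) : ℂ) := by
  simp only [pencil, sum_apply, smul_apply, inner_sum, inner_smul_right]
  refine Finset.sum_congr rfl fun k _ => ?_
  congr 1
  have h1 := Submodule.starProjection_eq_self_iff.2
    (Submodule.starProjection_apply_mem (part k) x)
  rw [← h1, ← Submodule.inner_starProjection_left_eq_right, inner_self_eq_norm_sq_to_K, h1]
  simp

variable [CompleteSpace X]

theorem pencil_one (h : IsHilbertSum ℂ (fun k => part k) fun k => (part k).subtypeₗᵢ) (x : X) :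
    pencil (fun k => (part k).starProjection) 1 x = x := by
  simpa [pencil] using sum_starProjection h x

theorem sum_norm_sq_starProjection
    (h : IsHilbertSum ℂ (fun k => part k) fun k => (part k).subtypeₗᵢ) (x : X) :
    ∑ k, ‖(part k).starProjection x‖ ^ 2 = ‖x‖ ^ 2 := by
  have h1 := inner_pencil (part := part) 1 x
  rw [pencil_one h, inner_self_eq_norm_sq_to_K] at h1
  simp only [Pi.one_apply, one_mul] at h1
  exact Complex.ofReal_injective (by push_cast; simpa using h1.symm)

theorem starProjection_pencil
    (h : IsHilbertSum ℂ (fun k => part k) fun k => (part k).subtypeₗᵢ) (z : Fin N → ℂ) (k : Fin N)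
    (x : X) : (part k).starProjection (pencil (fun k => (part k).starProjection) z x) =
      z k • (part k).starProjection x := by
  simp only [pencil, sum_apply, smul_apply, map_sum, map_smul]
  rw [Finset.sum_eq_single k]
  · rw [Submodule.starProjection_eq_self_iff.2 (Submodule.starProjection_apply_mem (part k) x)]
  · intro j _ hj
    rw [starProjection_apply_of_ne h.OrthogonalFamily hj.symm
      (Submodule.starProjection_apply_mem (part j) x), smul_zero]
  · simp

theorem pencil_pencil
    (h : IsHilbertSum ℂ (fun k => part k) fun k => (part k).subtypeₗᵢ) (z w : Fin N → ℂ) (x : X) :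
    pencil (fun k => (part k).starProjection) z (pencil (fun k => (part k).starProjection) w x) =
      pencil (fun k => (part k).starProjection) (z * w) x := by
  simp only [pencil, sum_apply, smul_apply]
  refine Finset.sum_congr rfl fun k _ => ?_
  have := starProjection_pencil h w k x
  simp only [pencil, sum_apply, smul_apply] at this
  rw [this, smul_smul, Pi.mul_apply]

theorem pencil_add {V : Type*} [NormedAddCommGroup V] [InnerProductSpace ℂ V]
    (A : Fin N → V →L[ℂ] V) (z w : Fin N → ℂ) : pencil A (z + w) = pencil A z + pencil A w := by
  simp [pencil, add_smul, Finset.sum_add_distrib]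

theorem pencil_sub {V : Type*} [NormedAddCommGroup V] [InnerProductSpace ℂ V]
    (A : Fin N → V →L[ℂ] V) (z w : Fin N → ℂ) : pencil A (z - w) = pencil A z - pencil A w := by
  simp [pencil, sub_smul, Finset.sum_sub_distrib]

theorem re_inner_pencil_ge
    (h : IsHilbertSum ℂ (fun k => part k) fun k => (part k).subtypeₗᵢ) {z : Fin N → ℂ} {δ : ℝ}
    (hz : ∀ k, δ ≤ (z k).re) (x : X) :
    δ * ‖x‖ ^ 2 ≤ (inner ℂ x (pencil (fun k => (part k).starProjection) z x)).re := by
  rw [inner_pencil, Complex.re_sum, ← sum_norm_sq_starProjection h, Finset.mul_sum]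
  refine Finset.sum_le_sum fun k _ => ?_
  rw [Complex.re_mul_ofReal]
  exact mul_le_mul_of_nonneg_right (hz k) (by positivity)

theorem exists_pos_le_re {z : Fin N → ℂ} (hz : z ∈ polyHalfPlane N) :
    ∃ δ : ℝ, 0 < δ ∧ ∀ k, δ ≤ (z k).re := by
  cases isEmpty_or_nonempty (Fin N) with
  | inl _ => exact ⟨1, one_pos, fun k => isEmptyElim k⟩
  | inr _ =>
    obtain ⟨k, hk⟩ := Finite.exists_min fun k => (z k).re
    exact ⟨_, hz k, hk⟩

end Projections

/-- The Lax–Milgram argument: a coercive bounded operator is invertible. -/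
theorem isUnit_of_re_inner_ge {V : Type*} [NormedAddCommGroup V] [InnerProductSpace ℂ V]
    [CompleteSpace V] {T : V →L[ℂ] V} {δ : ℝ} (hδ : 0 < δ)
    (h : ∀ x, δ * ‖x‖ ^ 2 ≤ (inner ℂ x (T x)).re) : IsUnit T := by
  refine T.isUnit_of_forall_le_norm_inner_map (c := ⟨δ, hδ.le⟩) hδ fun x => ?_
  rw [norm_inner_symm, mul_comm]
  exact (h x).trans (Complex.re_le_norm _)

/-! ### Long resolvent representations -/

section LongResolvent

theorem isRealFun_of_isLongResolvent {N : ℕ} {U : Type u}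
    [NormedAddCommGroup U] [InnerProductSpace ℂ U] {ι : U → U} {f : (Fin N → ℂ) → U →L[ℂ] U}
    {H : Type*} [NormedAddCommGroup H] [InnerProductSpace ℂ H]
    {A : Fin N → WithLp 2 (U × H) →L[ℂ] WithLp 2 (U × H)} {κ : H → H} (hι : IsAUI ι)
    (hκ : IsAUI κ) (hA : IsLongResolvent f A)
    (hreal : IsRealFun (sumMap ι κ) (Omega N) (pencil A)) : IsRealFun ι (Omega N) f := by
  refine (isRealFun_iff hι).2 fun z hz => ?_
  rw [hA.eq z hz, hA.eq _ (star_mem_Omega hz)]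
  exact intertwines_schur hι hκ (hA.isUnit _ (star_mem_Omega hz)) (hA.isUnit z hz)
    ((isRealFun_iff (hι.sumMap hκ)).1 hreal z hz)

variable {N : ℕ} {U : Type u} [NormedAddCommGroup U] [InnerProductSpace ℂ U] [CompleteSpace U]
  {ι : U → U} {f : (Fin N → ℂ) → U →L[ℂ] U}

/-- Summing z_k A_k gives S(ζ)* A(z) S(z) = S(ζ)* [f(z); 0], and the first component of S(ζ) is the
identity, so ζ drops out. -/
theorem exists_kernels_of_isLongResolvent {H : Type*} [NormedAddCommGroup H]
    [InnerProductSpace ℂ H] [CompleteSpace H]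
    {A : Fin N → WithLp 2 (U × H) →L[ℂ] WithLp 2 (U × H)} (hA : IsLongResolvent f A) :
    ∃ Φ : Fin N → (Fin N → ℂ) → (Fin N → ℂ) → U →L[ℂ] U,
      (∀ k, IsHolomorphicPSDKernel (polyHalfPlane N) (Φ k)) ∧
      ∀ z ∈ polyHalfPlane N, ∀ ζ ∈ polyHalfPlane N, f z = ∑ k, z k • Φ k z ζ := by
  have hu : ∀ z ∈ polyHalfPlane N, IsUnit (block₂₂ (pencil A z)) :=
    fun z hz => hA.isUnit z (polyHalfPlane_subset_Omega hz)
  refine ⟨fun k z ζ => ContinuousLinearMap.adjoint (schurColumn (pencil A ζ)) ∘L A k ∘L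
    schurColumn (pencil A z), fun k => isHolomorphicPSDKernel_factor (hA.psd k)
      (differentiableOn_schurColumn hu), fun z hz ζ hζ => ?_⟩
  ext u
  refine ext_inner_right ℂ fun v => ?_
  have h1 : (∑ k, z k • (ContinuousLinearMap.adjoint (schurColumn (pencil A ζ)) ∘L A k ∘L
      schurColumn (pencil A z))) u = ContinuousLinearMap.adjoint (schurColumn (pencil A ζ))
        (pencil A z (schurColumn (pencil A z) u)) := by
    simp [pencil]
  rw [h1, apply_schurColumn (hu z hz), ContinuousLinearMap.adjoint_inner_left, schurColumn_apply,
    WithLp.prod_inner_apply, hA.eq z (polyHalfPlane_subset_Omega hz)]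
  simp [schur]

/-- The conjugated kernels represent ι f(z̄) ι = f(z) as well, so the average of the two families
still represents f, and conjugation merely swaps its halves. -/
theorem exists_real_kernels (hι : IsAUI ι) (hf : IsRealFun ι (polyHalfPlane N) f)
    {Φ : Fin N → (Fin N → ℂ) → (Fin N → ℂ) → U →L[ℂ] U}
    (hΦ : ∀ k, IsHolomorphicPSDKernel (polyHalfPlane N) (Φ k))
    (h : ∀ z ∈ polyHalfPlane N, ∀ ζ ∈ polyHalfPlane N, f z = ∑ k, z k • Φ k z ζ) :
    ∃ Φ : Fin N → (Fin N → ℂ) → (Fin N → ℂ) → U →L[ℂ] U,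
      (∀ k, IsHolomorphicPSDKernel (polyHalfPlane N) (Φ k)) ∧
      (∀ z ∈ polyHalfPlane N, ∀ ζ ∈ polyHalfPlane N, f z = ∑ k, z k • Φ k z ζ) ∧
      ∀ k, IsRealFun ι (polyHalfPlane N ×ˢ polyHalfPlane N) fun p => Φ k p.1 p.2 := by
  refine ⟨fun k z ζ => ((1 / 2 : ℝ) : ℂ) • (Φ k z ζ + conjOp hι (Φ k (star z) (star ζ))),
    fun k => ((hΦ k).add ((hΦ k).conj hι fun _ => star_mem_polyHalfPlane)).smul (by norm_num),
    fun z hz ζ hζ => ?_, fun k => ?_⟩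
  · have h1 : f z = ∑ k, z k • conjOp hι (Φ k (star z) (star ζ)) := by
      rw [← (intertwines_iff_conjOp hι).1 ((isRealFun_iff hι).1 hf z hz),
        h _ (star_mem_polyHalfPlane hz) _ (star_mem_polyHalfPlane hζ), map_sum]
      refine Finset.sum_congr rfl fun k _ => ?_
      rw [map_smulₛₗ]
      simp
    calc f z = ((1 / 2 : ℝ) : ℂ) • (f z + f z) := by
          rw [← two_smul ℂ, smul_smul]; norm_num
      _ = ((1 / 2 : ℝ) : ℂ) • (∑ k, z k • Φ k z ζ +
            ∑ k, z k • conjOp hι (Φ k (star z) (star ζ))) := by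
          rw [← h1, ← h z hz ζ hζ]
      _ = _ := by
          rw [← Finset.sum_add_distrib, Finset.smul_sum]
          exact Finset.sum_congr rfl fun k _ => by rw [← smul_add, smul_comm]
  · refine (isRealFun_iff hι).2 fun p _ => ?_
    have h1 := ((intertwines_conjOp hι (Φ k (star p.1) (star p.2))).add hι
      ((intertwines_conjOp hι (Φ k p.1 p.2)).symm hι hι)).smul hι ((1 / 2 : ℝ) : ℂ)
    rw [add_comm (conjOp hι (Φ k (star p.1) (star p.2)))] at h1
    simpa using h1

/-! ### The long resolvent built from a real factorization -/

namespace RealFactorization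

variable (r : RealFactorization ι f)

/-- The pencil `P(z) = ∑ z_k P_k`. -/
def P (z : Fin N → ℂ) : r.X →L[ℂ] r.X := pencil (fun k => (r.part k).starProjection) z

theorem intertwines_P (z : Fin N → ℂ) : Intertwines r.conj r.conj (r.P z) (r.P (star z)) :=
  Intertwines.pencil r.isAUI r.real z

theorem inner_apply {z ζ : Fin N → ℂ} (hz : z ∈ polyHalfPlane N) (hζ : ζ ∈ polyHalfPlane N)
    (u v : U) : inner ℂ (r.h ζ v) (r.P z (r.h z u)) = inner ℂ v (f z u) := by
  rw [r.eq z hz ζ hζ, ContinuousLinearMap.comp_apply, ContinuousLinearMap.adjoint_inner_right]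
  rfl

/-- The closed span of the vectors `(h(z) - h(1)) u`. -/
def K : Submodule ℂ r.X :=
  (Submodule.span ℂ {x | ∃ z ∈ polyHalfPlane N, ∃ u, x = r.h z u - r.h 1 u}).topologicalClosure

instance : CompleteSpace r.K := (Submodule.isClosed_topologicalClosure _).completeSpace_coe

theorem sub_mem_K {z : Fin N → ℂ} (hz : z ∈ polyHalfPlane N) (u : U) :
    r.h z u - r.h 1 u ∈ r.K :=
  Submodule.le_topologicalClosure _ (Submodule.subset_span ⟨z, hz, u, rfl⟩)

theorem conj_mem_K {x : r.X} (hx : x ∈ r.K) : r.conj x ∈ r.K := by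
  refine r.isAUI.mem_closure_span ?_ hx
  rintro _ ⟨z, hz, u, rfl⟩
  refine ⟨star z, star_mem_polyHalfPlane hz, ι u, ?_⟩
  rw [r.isAUI.map_sub, r.intertwines z hz, r.intertwines 1 one_mem_polyHalfPlane, star_one]

/-- The operator `(u, x) ↦ h(1) u + x`. -/
def W : WithLp 2 (U × r.K) →L[ℂ] r.X :=
  r.h 1 ∘L WithLp.fstL 2 ℂ U r.K + r.K.subtypeL ∘L WithLp.sndL 2 ℂ U r.K

theorem W_apply (x : WithLp 2 (U × r.K)) : r.W x = r.h 1 x.fst + x.snd := rfl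

/-- The coefficients of the pencil of the long resolvent representation. -/
def coeff (k : Fin N) : WithLp 2 (U × r.K) →L[ℂ] WithLp 2 (U × r.K) :=
  ContinuousLinearMap.adjoint r.W ∘L (r.part k).starProjection ∘L r.W

theorem pencil_coeff (z : Fin N → ℂ) (x : WithLp 2 (U × r.K)) :
    pencil r.coeff z x = ContinuousLinearMap.adjoint r.W (r.P z (r.W x)) := by
  simp [pencil, coeff, P]

/-- The anti-unitary involution of `K`. -/
def conjK (x : r.K) : r.K := ⟨r.conj x, r.conj_mem_K x.2⟩

theorem isAUI_conjK : IsAUI r.conjK := r.isAUI.restrict fun _ => r.conj_mem_K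

theorem intertwines_W : Intertwines (sumMap ι r.conjK) r.conj r.W r.W := fun x => by
  rw [W_apply, W_apply, r.isAUI.map_add, r.intertwines 1 one_mem_polyHalfPlane, star_one]
  rfl

theorem isRealFun_pencil (hι : IsAUI ι) :
    IsRealFun (sumMap ι r.conjK) (Omega N) (pencil r.coeff) := by
  have hs := hι.sumMap r.isAUI_conjK
  refine (isRealFun_iff hs).2 fun z _ => ?_
  have h1 := Intertwines.pencil (A := r.coeff) hs
    (fun k => (r.intertwines_W.adjoint hs r.isAUI).comp
      (Intertwines.comp (r.real k) r.intertwines_W)) (star z)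
  rwa [star_star] at h1

/-- The block d(z) is the compression of P(z) to K, because `W` is the inclusion on the second
summand. On Π^N it is coercive with constant min Re z_k; on Ω_N a unimodular scalar is pulled out
first. -/
theorem isUnit_block₂₂ {z : Fin N → ℂ} (hz : z ∈ Omega N) :
    IsUnit (block₂₂ (pencil r.coeff z)) := by
  obtain ⟨l, hl, w, hw, rfl⟩ := hz
  have hl0 : l ≠ 0 := fun h => by simp [h] at hl
  obtain ⟨δ, hδ, hδw⟩ := exists_pos_le_re hw
  have h1 : block₂₂ (pencil r.coeff (l • w)) = l • block₂₂ (pencil r.coeff w) := by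
    rw [pencil_smul]; ext; simp [block₂₂]
  rw [h1]
  refine IsUnit.smul (Units.mk0 l hl0) (isUnit_of_re_inner_ge hδ fun x => ?_)
  have h2 : inner ℂ x (block₂₂ (pencil r.coeff w) x) =
      inner ℂ (inr U r.K x) (pencil r.coeff w (inr U r.K x)) := by
    rw [WithLp.prod_inner_apply]
    simp [inr, block₂₂]
  have h3 : r.W (inr U r.K x) = x := by simp [W_apply, inr]
  rw [h2, pencil_coeff, ContinuousLinearMap.adjoint_inner_right, h3]
  exact re_inner_pencil_ge r.isHilbertSum hδw (x : r.X)

/-- The vector (u, (h(z) - h(1))u) is sent by `W` to h(z)u. Then `W`* maps P(z)h(z)u to (f(z)u, 0):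
the first entry is the factorization at ζ = 1, and the second vanishes since P(z)h(z)u is orthogonal
to K. -/
theorem schur_pencil_eq {z : Fin N → ℂ} (hz : z ∈ polyHalfPlane N) :
    schur (pencil r.coeff z) = f z := by
  ext u
  refine schur_eq_of_apply (w := ⟨_, r.sub_mem_K hz u⟩)
    (r.isUnit_block₂₂ (polyHalfPlane_subset_Omega hz)) ?_
  rw [pencil_coeff]
  have h1 : r.W (WithLp.toLp 2 (u, ⟨_, r.sub_mem_K hz u⟩)) = r.h z u := by simp [W_apply]
  rw [h1]
  refine ext_inner_left ℂ fun x => ?_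
  rw [ContinuousLinearMap.adjoint_inner_right, W_apply, inner_add_left,
    r.inner_apply hz one_mem_polyHalfPlane, WithLp.prod_inner_apply]
  have h2 : r.K ≤ (ℂ ∙ r.P z (r.h z u))ᗮ := by
    refine Submodule.topologicalClosure_minimal _ (Submodule.span_le.2 ?_)
      (Submodule.isClosed_orthogonal _)
    rintro _ ⟨ζ, hζ, v, rfl⟩
    rw [SetLike.mem_coe, Submodule.mem_orthogonal_singleton_iff_inner_left, inner_sub_left,
      r.inner_apply hz hζ, r.inner_apply hz one_mem_polyHalfPlane, sub_self]
  rw [Submodule.mem_orthogonal_singleton_iff_inner_left.1 (h2 x.snd.2)]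
  simp

theorem isLongResolvent (hf : DifferentiableOn ℂ f (Omega N)) : IsLongResolvent f r.coeff where
  psd k := (ContinuousLinearMap.IsPositive.of_isStarProjection
    isStarProjection_starProjection).adjoint_conj r.W
  isUnit z hz := r.isUnit_block₂₂ hz
  eq z hz := by
    change f z = schur (pencil r.coeff z)
    obtain ⟨l, hl, w, hw, rfl⟩ := hz
    have hl0 : l ≠ 0 := fun h => by simp [h] at hl
    have hu {w : Fin N → ℂ} (hw : w ∈ polyHalfPlane N) :=
      r.isUnit_block₂₂ (polyHalfPlane_subset_Omega hw)
    rw [pencil_smul, schur_smul hl0 (hu hw), r.schur_pencil_eq hw]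
    refine apply_smul_of_homogeneous hf (fun z hz μ hμz => ?_) hw hl0
    by_cases hμ : μ = 0
    · subst hμ
      rw [← r.schur_pencil_eq hμz]
      ext u
      simp [schur, pencil, block₁₁, block₁₂]
    · rw [← r.schur_pencil_eq hz, ← r.schur_pencil_eq hμz, pencil_smul, schur_smul hμ (hu hz)]

end RealFactorization

end LongResolvent

/-! ### Transfer functions of Agler colligations -/

section Cayley

variable {N : ℕ}

/-- The Cayley transform `𝔻^N → Π^N`. -/
def toHalfPlane (w : Fin N → ℂ) : Fin N → ℂ := fun k => (1 + w k) / (1 - w k)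

/-- The inverse Cayley transform `Π^N → 𝔻^N`. -/
def toDisk (z : Fin N → ℂ) : Fin N → ℂ := fun k => (z k - 1) / (z k + 1)

theorem add_one_ne_zero_of_re_pos {a : ℂ} (ha : 0 < a.re) : a + 1 ≠ 0 := fun h => by
  have := congrArg Complex.re h
  simp at this
  linarith

theorem one_sub_ne_zero_of_norm_lt {a : ℂ} (ha : ‖a‖ < 1) : 1 - a ≠ 0 := fun h => by
  rw [sub_eq_zero] at h
  simp [← h] at ha

theorem toHalfPlane_mem {w : Fin N → ℂ} (hw : w ∈ polyDisk N) :
    toHalfPlane w ∈ polyHalfPlane N := fun k => by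
  have h0 := one_sub_ne_zero_of_norm_lt (hw k)
  have h1 : Complex.normSq (w k) < 1 := by
    rw [Complex.normSq_eq_norm_sq]
    exact pow_lt_one₀ (norm_nonneg _) (hw k) two_ne_zero
  rw [toHalfPlane, Complex.div_re, ← add_div]
  refine div_pos ?_ (Complex.normSq_pos.2 h0)
  rw [Complex.normSq_apply] at h1
  simp
  nlinarith

theorem toDisk_mem {z : Fin N → ℂ} (hz : z ∈ polyHalfPlane N) : toDisk z ∈ polyDisk N :=
  fun k => by
  have h0 := add_one_ne_zero_of_re_pos (hz k)
  have h1 := hz k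
  rw [toDisk, norm_div, div_lt_one (norm_pos_iff.2 h0)]
  refine lt_of_pow_lt_pow_left₀ 2 (norm_nonneg _) ?_
  rw [← Complex.normSq_eq_norm_sq, ← Complex.normSq_eq_norm_sq, Complex.normSq_apply,
    Complex.normSq_apply]
  simp
  nlinarith

theorem toHalfPlane_toDisk {z : Fin N → ℂ} (hz : z ∈ polyHalfPlane N) :
    toHalfPlane (toDisk z) = z := by
  funext k
  have h0 := add_one_ne_zero_of_re_pos (hz k)
  simp only [toHalfPlane, toDisk]
  have h1 : 1 + (z k - 1) / (z k + 1) = 2 * z k / (z k + 1) := by field_simp; ring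
  have h2 : 1 - (z k - 1) / (z k + 1) = 2 / (z k + 1) := by field_simp; ring
  rw [h1, h2]
  field_simp

theorem mul_toHalfPlane_add_one {w : Fin N → ℂ} (hw : w ∈ polyDisk N) :
    w * (toHalfPlane w + 1) = toHalfPlane w - 1 := by
  funext k
  have h0 := one_sub_ne_zero_of_norm_lt (hw k)
  simp only [toHalfPlane, Pi.mul_apply, Pi.add_apply, Pi.sub_apply, Pi.one_apply]
  field_simp
  ring

theorem mul_one_sub_toDisk {z : Fin N → ℂ} (hz : z ∈ polyHalfPlane N) :
    z * (1 - toDisk z) = 1 + toDisk z := by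
  funext k
  have h0 := add_one_ne_zero_of_re_pos (hz k)
  simp only [toDisk, Pi.mul_apply, Pi.add_apply, Pi.sub_apply, Pi.one_apply]
  field_simp
  ring

theorem star_toDisk (z : Fin N → ℂ) : star (toDisk z) = toDisk (star z) := by
  funext k
  simp [toDisk]

theorem differentiableOn_toDisk : DifferentiableOn ℂ (toDisk (N := N)) (polyHalfPlane N) := by
  refine differentiableOn_pi.2 fun k => ?_
  intro z hz
  have h0 := add_one_ne_zero_of_re_pos (hz k)
  have h1 : DifferentiableAt ℂ (fun z : Fin N → ℂ => (z k - 1) / (z k + 1)) z := by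
    fun_prop (disch := assumption)
  exact h1.differentiableWithinAt

theorem exists_norm_le_lt_one {w : Fin N → ℂ} (hw : w ∈ polyDisk N) :
    ∃ r : ℝ, 0 ≤ r ∧ r < 1 ∧ ∀ k, ‖w k‖ ≤ r := by
  cases isEmpty_or_nonempty (Fin N) with
  | inl _ => exact ⟨0, le_rfl, one_pos, fun k => isEmptyElim k⟩
  | inr _ =>
    obtain ⟨k, hk⟩ := Finite.exists_max fun k => ‖w k‖
    exact ⟨_, norm_nonneg _, hw k, hk⟩

end Cayley

theorem norm_pencil_le {N : ℕ} {X : Type*} [NormedAddCommGroup X] [InnerProductSpace ℂ X]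
    [CompleteSpace X] {part : Fin N → Submodule ℂ X} [∀ k, CompleteSpace (part k)]
    (h : IsHilbertSum ℂ (fun k => part k) fun k => (part k).subtypeₗᵢ) {w : Fin N → ℂ} {r : ℝ}
    (hr : 0 ≤ r) (hw : ∀ k, ‖w k‖ ≤ r) : ‖pencil (fun k => (part k).starProjection) w‖ ≤ r := by
  refine ContinuousLinearMap.opNorm_le_bound _ hr fun x => ?_
  refine le_of_sq_le_sq ?_ (by positivity)
  rw [← sum_norm_sq_starProjection h, mul_pow, ← sum_norm_sq_starProjection h x, Finset.mul_sum]
  refine Finset.sum_le_sum fun k _ => ?_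
  rw [starProjection_pencil h, norm_smul, mul_pow]
  gcongr
  exact hw k

namespace AglerColligation

variable {N : ℕ} {U : Type u} [NormedAddCommGroup U] [InnerProductSpace ℂ U] [CompleteSpace U]
  (α : AglerColligation N U)

theorem norm_block₁₁_le : ‖block₁₁ α.op‖ ≤ 1 := by
  refine ContinuousLinearMap.opNorm_le_bound _ zero_le_one fun x => ?_
  have h1 : ‖α.op (inl α.X U x)‖ = ‖x‖ := by
    rw [ContinuousLinearMap.norm_map_of_mem_unitary α.unitary]
    simp [inl]
  rw [one_mul, ← h1]
  exact WithLp.norm_fst_le α.X (α.op (inl α.X U x))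

theorem isUnit_one_sub {w : Fin N → ℂ} (hw : w ∈ polyDisk N) :
    IsUnit (1 - block₁₁ α.op ∘L pencil α.proj w) := by
  obtain ⟨r, hr0, hr1, hr⟩ := exists_norm_le_lt_one hw
  refine isUnit_one_sub_of_norm_lt_one (lt_of_le_of_lt ?_ hr1)
  refine (ContinuousLinearMap.opNorm_comp_le _ _).trans ?_
  have h2 : ‖pencil α.proj w‖ ≤ r := norm_pencil_le α.isHilbertSum hr0 hr
  calc _ ≤ 1 * r := mul_le_mul α.norm_block₁₁_le h2 (norm_nonneg _) zero_le_one
    _ = r := one_mul r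

/-- The state `(I - A P(w))⁻¹ B`. -/
def state (w : Fin N → ℂ) : U →L[ℂ] α.X :=
  Ring.inverse (1 - block₁₁ α.op ∘L pencil α.proj w) ∘L block₁₂ α.op

/-- The feedback equations of the colligation: input (P(w)x, u) produces output (x, 𝓕(w)u). They
replace the explicit formula in what follows. -/
theorem op_apply_state {w : Fin N → ℂ} (hw : w ∈ polyDisk N) (u : U) :
    α.op (WithLp.toLp 2 (pencil α.proj w (α.state w u), u)) =
      WithLp.toLp 2 (α.state w u, α.transfer w u) := by
  have h : (1 - block₁₁ α.op ∘L pencil α.proj w) (α.state w u) = block₁₂ α.op u :=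
    congr($(Ring.mul_inverse_cancel _ (α.isUnit_one_sub hw)) (block₁₂ α.op u))
  rw [apply_toLp]
  refine congrArg (WithLp.toLp 2) (Prod.ext ?_ ?_)
  · simp only [← h]
    simp
  · simp only [transfer, state]
    simp [add_comm]

theorem transfer_eq_of_apply {w : Fin N → ℂ} (hw : w ∈ polyDisk N) {x : α.X} {u v : U}
    (h : α.op (WithLp.toLp 2 (pencil α.proj w x, u)) = WithLp.toLp 2 (x, v)) :
    α.transfer w u = v := by
  rw [apply_toLp] at h
  have h1 : block₁₁ α.op (pencil α.proj w x) + block₁₂ α.op u = x := congrArg WithLp.fst h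
  have h2 : block₂₁ α.op (pencil α.proj w x) + block₂₂ α.op u = v := congrArg WithLp.snd h
  have h3 : (1 - block₁₁ α.op ∘L pencil α.proj w) x = block₁₂ α.op u := by
    rw [sub_apply, ContinuousLinearMap.comp_apply, sub_eq_iff_eq_add, add_comm, h1]; rfl
  have h4 : Ring.inverse (1 - block₁₁ α.op ∘L pencil α.proj w) (block₁₂ α.op u) = x := by
    rw [← h3]
    exact congr($(Ring.inverse_mul_cancel _ (α.isUnit_one_sub hw)) x)
  rw [← h2, add_comm, transfer, add_apply]
  simp only [ContinuousLinearMap.comp_apply, h4]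

variable {α} {ι : U → U} {κ : α.X → α.X}

theorem intertwines_state (hι : IsAUI ι) (hκ : IsAUI κ) (hP : ∀ k, IsRealOp κ (α.proj k))
    (hop : IsRealOp (sumMap κ ι) α.op) {w : Fin N → ℂ} (hw : w ∈ polyDisk N) :
    Intertwines ι κ (α.state w) (α.state (star w)) := by
  have hop' : Intertwines (sumMap κ ι) (sumMap κ ι) α.op α.op := hop
  have hw' : star w ∈ polyDisk N := fun k => by simpa using hw k
  exact (Intertwines.ringInverse (Intertwines.one.sub hκ
    ((intertwines_block₁₁ hι hop').comp (Intertwines.pencil hκ hP w)))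
    (α.isUnit_one_sub hw) (α.isUnit_one_sub hw')).comp (intertwines_block₁₂ hκ hop')

theorem intertwines_transfer (hι : IsAUI ι) (hκ : IsAUI κ) (hP : ∀ k, IsRealOp κ (α.proj k))
    (hop : IsRealOp (sumMap κ ι) α.op) {w : Fin N → ℂ} (hw : w ∈ polyDisk N) :
    Intertwines ι ι (α.transfer w) (α.transfer (star w)) := by
  have hop' : Intertwines (sumMap κ ι) (sumMap κ ι) α.op α.op := hop
  exact (intertwines_block₂₂ hκ hop').add hι ((intertwines_block₂₁ hι hop').comp
    ((Intertwines.pencil hκ hP w).comp (intertwines_state hι hκ hP hop hw)))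

variable (α) in
theorem differentiableOn_state : DifferentiableOn ℂ α.state (polyDisk N) := by
  have h1 : DifferentiableOn ℂ (fun w => 1 - block₁₁ α.op ∘L pencil α.proj w) (polyDisk N) :=
    DifferentiableOn.const_sub ((differentiableOn_const (block₁₁ α.op)).clm_comp
      (differentiable_pencil α.proj).differentiableOn) _
  have h2 : DifferentiableOn ℂ
      (fun w => Ring.inverse (1 - block₁₁ α.op ∘L pencil α.proj w)) (polyDisk N) := fun w hw =>
    DifferentiableAt.comp_differentiableWithinAt (g := Ring.inverse)
      (f := fun w => 1 - block₁₁ α.op ∘L pencil α.proj w) w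
      (differentiableAt_inverse (α.isUnit_one_sub hw)) (h1 w hw)
  exact h2.clm_comp (differentiableOn_const (block₁₂ α.op))

end AglerColligation

/-! ### From a colligation to kernels -/

section OfColligation

variable {N : ℕ} {U : Type u} [NormedAddCommGroup U] [InnerProductSpace ℂ U] [CompleteSpace U]
  {f : (Fin N → ℂ) → U →L[ℂ] U} (α : AglerColligation N U)

/-- The factor `½ (I - P(w)) (I - A P(w))⁻¹ B (f(z) + I)`, where `w` is the inverse Cayley
transform of `z`. -/
def aglerFactor (f : (Fin N → ℂ) → U →L[ℂ] U) (z : Fin N → ℂ) : U →L[ℂ] α.X :=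
  (1 / 2 : ℂ) • (pencil α.proj (1 - toDisk z) ∘L α.state (toDisk z) ∘L (f z + 1))

theorem transfer_apply_add_one (hα : IsDoubleCayley f α.transfer) {z : Fin N → ℂ}
    (hz : z ∈ polyHalfPlane N) (u : U) :
    IsUnit (f z + 1) ∧ α.transfer (toDisk z) ((f z + 1) u) = (f z - 1) u := by
  obtain ⟨h1, h2⟩ := hα _ (toDisk_mem hz)
  have h3 : cayleyVar f (toDisk z) = f z := congrArg f (toHalfPlane_toDisk hz)
  rw [h3] at h1 h2
  refine ⟨h1, ?_⟩
  have h4 : Ring.inverse (f z + 1) ((f z + 1) u) = u :=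
    congr($(Ring.inverse_mul_cancel _ h1) u)
  rw [h2, mul_apply_eq_comp, h4]

theorem pencil_aglerFactor {z : Fin N → ℂ} (hz : z ∈ polyHalfPlane N) (u : U) :
    pencil α.proj z (aglerFactor α f z u) =
      (1 / 2 : ℂ) • pencil α.proj (1 + toDisk z) (α.state (toDisk z) ((f z + 1) u)) := by
  rw [aglerFactor, smul_apply, map_smul, ContinuousLinearMap.comp_apply]
  congr 1
  refine (pencil_pencil α.isHilbertSum _ _ _).trans ?_
  rw [mul_one_sub_toDisk hz]
  rfl

/-- The vector is x = (P(w)s, (f(z) + I)u) with s the state driven by (f(z) + I)u, so that U x = (s,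
(f(z) - I)u). The relation z(1 - w) = 1 + w turns (I + P(w))s into 2 P(z) applied to the factor. -/
theorem op_apply_aglerFactor (hα : IsDoubleCayley f α.transfer) {z : Fin N → ℂ}
    (hz : z ∈ polyHalfPlane N) (u : U) :
    ∃ x, x + α.op x = WithLp.toLp 2
        ((2 : ℂ) • pencil α.proj z (aglerFactor α f z u), (2 : ℂ) • f z u) ∧
      x - α.op x = WithLp.toLp 2 (-(2 : ℂ) • aglerFactor α f z u, (2 : ℂ) • u) := by
  have h1 := α.op_apply_state (toDisk_mem hz) ((f z + 1) u)
  rw [(transfer_apply_add_one α hα hz u).2] at h1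
  have hone (x) : pencil α.proj 1 x = x := pencil_one (part := α.part) α.isHilbertSum x
  refine ⟨_, (congrArg (_ + ·) h1).trans ?_, (congrArg (_ - ·) h1).trans ?_⟩
  · rw [pencil_aglerFactor α hz, ← WithLp.toLp_add, smul_smul]
    refine congrArg (WithLp.toLp 2) (Prod.ext ?_ ?_)
    · simp only [pencil_add, add_apply, hone]
      simp [add_comm]
    · simp [two_smul]
  · rw [aglerFactor, smul_apply, ← WithLp.toLp_sub, smul_smul]
    refine congrArg (WithLp.toLp 2) (Prod.ext ?_ ?_)
    · simp only [pencil_sub, sub_apply, hone, ContinuousLinearMap.comp_apply]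
      simp
    · simp [two_smul]

/-- Since U² = I and U = U*, the vectors x + Ux and y - Uy lie in the eigenspaces for 1 and -1,
hence are orthogonal; written out by components, this is the factorization of f. -/
theorem inner_aglerFactor (hsa : IsSelfAdjoint α.op) (hα : IsDoubleCayley f α.transfer)
    {z ζ : Fin N → ℂ} (hz : z ∈ polyHalfPlane N) (hζ : ζ ∈ polyHalfPlane N) (u v : U) :
    inner ℂ (aglerFactor α f ζ v) (pencil α.proj z (aglerFactor α f z u)) = inner ℂ v (f z u) := by
  obtain ⟨x, hx, -⟩ := op_apply_aglerFactor α hα hz u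
  obtain ⟨y, -, hy⟩ := op_apply_aglerFactor α hα hζ v
  have hinv (x) : α.op (α.op x) = x := by
    have := (Unitary.mem_iff.1 α.unitary).1
    rw [hsa.star_eq] at this
    exact congr($this x)
  have h1 : inner ℂ (y - α.op y) (x + α.op x) = 0 := by
    have hsym (a b) : inner ℂ (α.op a) b = inner ℂ a (α.op b) := by
      rw [← ContinuousLinearMap.adjoint_inner_right, ← ContinuousLinearMap.star_eq_adjoint,
        hsa.star_eq]
    rw [inner_sub_left, hsym, map_add, hinv, inner_add_right, inner_add_right]
    ring
  rw [hx, hy, WithLp.prod_inner_apply] at h1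
  simp only [inner_smul_left, inner_smul_right, map_neg, map_ofNat] at h1
  linear_combination (1 / 4 : ℂ) * (-h1)

theorem differentiableOn_aglerFactor (hf : DifferentiableOn ℂ f (polyHalfPlane N)) :
    DifferentiableOn ℂ (aglerFactor α f) (polyHalfPlane N) := by
  have h1 : DifferentiableOn ℂ (fun z => pencil α.proj (1 - toDisk z)) (polyHalfPlane N) :=
    (differentiable_pencil α.proj).comp_differentiableOn
      (DifferentiableOn.const_sub differentiableOn_toDisk _)
  have h2 : DifferentiableOn ℂ (fun z => α.state (toDisk z)) (polyHalfPlane N) :=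
    α.differentiableOn_state.comp differentiableOn_toDisk fun z hz => toDisk_mem hz
  exact (h1.clm_comp (h2.clm_comp (hf.add_const _))).const_smul (1 / 2 : ℂ)

variable {α} {ι : U → U} {κ : α.X → α.X}

/-- The transfer function is real, and I - 𝓕 = 2(f + I)⁻¹ recovers f from it. -/
theorem isRealFun_of_colligation (hι : IsAUI ι) (hκ : IsAUI κ)
    (hP : ∀ k, IsRealOp κ (α.proj k)) (hop : IsRealOp (sumMap κ ι) α.op)
    (hα : IsDoubleCayley f α.transfer) : IsRealFun ι (polyHalfPlane N) f := by
  refine (isRealFun_iff hι).2 fun z hz u => ?_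
  have hz' := star_mem_polyHalfPlane hz
  have hw := toDisk_mem hz
  have h1 (x) : x - α.transfer (toDisk z) x =
      (2 : ℂ) • Ring.inverse (f z + 1) x := by
    obtain ⟨y, rfl⟩ : ∃ y, x = (f z + 1) y := ⟨Ring.inverse (f z + 1) x,
      congr($((Ring.mul_inverse_cancel _ (transfer_apply_add_one α hα hz 0).1).symm) x)⟩
    have h3 : Ring.inverse (f z + 1) ((f z + 1) y) = y :=
      congr($(Ring.inverse_mul_cancel _ (transfer_apply_add_one α hα hz 0).1) y)
    rw [(transfer_apply_add_one α hα hz y).2, h3]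
    simp [two_smul]
  have h2 : ι ((f (star z) + 1) u) - α.transfer (toDisk z) (ι ((f (star z) + 1) u)) =
      (2 : ℂ) • ι u := by
    have h3 := AglerColligation.intertwines_transfer hι hκ hP hop (toDisk_mem hz')
    rw [star_toDisk, star_star] at h3
    rw [← h3, (transfer_apply_add_one α hα hz' u).2, ← hι.map_sub]
    simp only [add_apply, sub_apply, one_apply_eq_self, add_sub_sub_cancel]
    rw [hι.map_add, two_smul]
  rw [h1] at h2
  have h3 : ι ((f (star z) + 1) u) = (f z + 1) (ι u) := by
    rw [← smul_right_injective U (two_ne_zero : (2 : ℂ) ≠ 0) h2]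
    exact congr($((Ring.mul_inverse_cancel _ (transfer_apply_add_one α hα hz 0).1).symm) _)
  simpa [hι.map_add] using h3

theorem exists_real_kernels_of_colligation (hf : DifferentiableOn ℂ f (polyHalfPlane N))
    (hι : IsAUI ι) (hκ : IsAUI κ)
    (hP : ∀ k, IsRealOp κ (α.proj k)) (hop : IsRealOp (sumMap κ ι) α.op)
    (hsa : IsSelfAdjoint α.op) (hα : IsDoubleCayley f α.transfer) :
    ∃ Φ : Fin N → (Fin N → ℂ) → (Fin N → ℂ) → U →L[ℂ] U,
      (∀ k, IsHolomorphicPSDKernel (polyHalfPlane N) (Φ k)) ∧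
      (∀ z ∈ polyHalfPlane N, ∀ ζ ∈ polyHalfPlane N, f z = ∑ k, z k • Φ k z ζ) ∧
      ∀ k, IsRealFun ι (polyHalfPlane N ×ˢ polyHalfPlane N) fun p => Φ k p.1 p.2 := by
  have hreal : ∀ z ∈ polyHalfPlane N,
      Intertwines ι κ (aglerFactor α f (star z)) (aglerFactor α f z) := fun z hz => by
    have hz' := star_mem_polyHalfPlane hz
    have hfz := (isRealFun_iff hι).1 (isRealFun_of_colligation hι hκ hP hop hα) z hz
    have h1 := ((Intertwines.pencil hκ hP (1 - toDisk (star z))).comp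
      ((AglerColligation.intertwines_state hι hκ hP hop (toDisk_mem hz')).comp
        (hfz.add hι Intertwines.one))).smul hκ (1 / 2)
    rw [star_sub, star_toDisk, star_star, star_one] at h1
    simpa [aglerFactor] using h1
  refine ⟨fun k z ζ => ContinuousLinearMap.adjoint (aglerFactor α f ζ) ∘L α.proj k ∘L
    aglerFactor α f z, fun k => isHolomorphicPSDKernel_factor
      (.of_isStarProjection isStarProjection_starProjection)
      (differentiableOn_aglerFactor α hf), fun z hz ζ hζ => ?_, fun k => ?_⟩
  · ext u
    refine ext_inner_left ℂ fun v => ?_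
    rw [← inner_aglerFactor α hsa hα hz hζ u v, ← ContinuousLinearMap.adjoint_inner_right]
    simp [pencil]
  · refine (isRealFun_iff hι).2 fun p hp => ?_
    exact ((hreal _ hp.2).adjoint hι hκ).comp (Intertwines.comp (hP k) (hreal _ hp.1))

end OfColligation

/-! ### From a factorization to a colligation -/

namespace RealFactorization

variable {N : ℕ} {U : Type u} [NormedAddCommGroup U] [InnerProductSpace ℂ U] [CompleteSpace U]
  {ι : U → U} {f : (Fin N → ℂ) → U →L[ℂ] U} (r : RealFactorization ι f)

/-- The closed span of the vectors `(P(z) h(z) u, f(z) u)`. -/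
def M : Submodule ℂ (WithLp 2 (r.X × U)) :=
  (Submodule.span ℂ {x | ∃ z ∈ polyHalfPlane N, ∃ u,
    x = WithLp.toLp 2 (r.P z (r.h z u), f z u)}).topologicalClosure

instance : CompleteSpace r.M := (Submodule.isClosed_topologicalClosure _).completeSpace_coe

/-- The reflection in `M`. -/
def op : WithLp 2 (r.X × U) →L[ℂ] WithLp 2 (r.X × U) :=
  (2 : ℂ) • r.M.starProjection - 1

theorem op_apply (x : WithLp 2 (r.X × U)) : r.op x = r.M.reflection x := by
  rw [Submodule.reflection_apply, op, sub_apply, smul_apply, two_smul, two_nsmul]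
  rfl

theorem isSelfAdjoint_op : IsSelfAdjoint r.op :=
  ((IsSelfAdjoint.ofNat 2).smul (isSelfAdjoint_starProjection r.M)).sub (.one _)

theorem op_mul_op : r.op * r.op = 1 := by
  ext1 x
  rw [mul_apply_eq_comp, op_apply, op_apply, Submodule.reflection_reflection]
  rfl

/-- The colligation whose operator is the reflection in `M`. -/
def colligation : AglerColligation N U where
  X := r.X
  part := r.part
  isHilbertSum := r.isHilbertSum
  op := r.op
  unitary := by
    rw [Unitary.mem_iff, r.isSelfAdjoint_op.star_eq, op_mul_op, and_self]

theorem op_apply_range {z : Fin N → ℂ} (hz : z ∈ polyHalfPlane N) (u : U) :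
    r.op (WithLp.toLp 2 (r.P z (r.h z u), f z u)) = WithLp.toLp 2 (r.P z (r.h z u), f z u) := by
  rw [op_apply]
  exact Submodule.reflection_mem_subspace_eq_self
    (Submodule.le_topologicalClosure _ (Submodule.subset_span ⟨z, hz, u, rfl⟩))

/-- By the factorization, ⟨P(ζ)h(ζ)v, h(z)u⟩ = ⟨f(ζ)v, u⟩, so (-h(z)u, u) is orthogonal to M. -/
theorem op_apply_orthogonal {z : Fin N → ℂ} (hz : z ∈ polyHalfPlane N) (u : U) :
    r.op (WithLp.toLp 2 (-r.h z u, u)) = -WithLp.toLp 2 (-r.h z u, u) := by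
  rw [op_apply]
  refine Submodule.reflection_mem_subspace_orthogonalComplement_eq_neg ?_
  rw [M, Submodule.orthogonal_closure]
  refine (Submodule.mem_orthogonal _ _).2 fun x hx => ?_
  rw [← Submodule.mem_orthogonal_singleton_iff_inner_left]
  refine (Submodule.span_le (p := (ℂ ∙ _)ᗮ)).2 ?_ hx
  rintro _ ⟨ζ, hζ, v, rfl⟩
  rw [SetLike.mem_coe, Submodule.mem_orthogonal_singleton_iff_inner_left,
    WithLp.prod_inner_apply, ← inner_conj_symm, ← inner_conj_symm (f ζ v),
    ← r.inner_apply hζ hz]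
  simp

/-- The generators of M are permuted by the involution because h, P and f are all real; hence the
projection onto M, and the reflection, are real. -/
theorem isRealOp_op (hι : IsAUI ι) (hf : IsRealFun ι (polyHalfPlane N) f) :
    IsRealOp (sumMap r.conj ι) r.op := by
  have hs := r.isAUI.sumMap hι
  have h1 (x) : sumMap r.conj ι (r.M.starProjection x) =
      r.M.starProjection (sumMap r.conj ι x) := by
    refine hs.starProjection_map (fun x hx => hs.mem_closure_span ?_ hx) x
    rintro _ ⟨z, hz, u, rfl⟩
    refine ⟨star z, star_mem_polyHalfPlane hz, ι u, ?_⟩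
    have h2 := (isRealFun_iff hι).1 hf _ (star_mem_polyHalfPlane hz) u
    rw [star_star] at h2
    rw [← h2, ← r.intertwines z hz, ← r.intertwines_P z]
    rfl
  intro x
  simp only [op, sub_apply, smul_apply, hs.map_sub, hs.map_smul, h1, star_ofNat]
  rfl

theorem re_inner_nonneg (r : RealFactorization ι f) {z : Fin N → ℂ} (hz : z ∈ polyHalfPlane N)
    (u : U) :
    0 ≤ (inner ℂ u (f z u)).re := by
  rw [← r.inner_apply hz hz]
  simpa [P] using re_inner_pencil_ge r.isHilbertSum (δ := 0) (fun k => (hz k).le) (r.h z u)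

/-- The factorization at ζ = z gives Re f ≥ 0, so F + I is coercive. Adding the fixed vector
(P(z)h(z)u, f(z)u) to the negated one (-h(z)u, u) shows how the reflection acts on a vector with
input (F + I)u. -/
theorem isDoubleCayley : IsDoubleCayley f r.colligation.transfer := by
  intro w hw
  have hz := toHalfPlane_mem hw
  have hu : IsUnit (cayleyVar f w + 1) := by
    refine isUnit_of_re_inner_ge one_pos fun u => ?_
    have h1 : (inner ℂ u u : ℂ).re = ‖u‖ ^ 2 := by
      rw [← norm_sq_eq_re_inner (𝕜 := ℂ) u |>.symm]; rfl
    rw [add_apply, inner_add_right, Complex.add_re, one_mul]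
    have h2 := r.re_inner_nonneg hz u
    change _ ≤ (inner ℂ u (f (toHalfPlane w) u)).re + (inner ℂ u u : ℂ).re
    linarith
  refine ⟨hu, ?_⟩
  ext v
  obtain ⟨u, rfl⟩ : ∃ u, v = (cayleyVar f w + 1) u := ⟨Ring.inverse (cayleyVar f w + 1) v,
    congr($((Ring.mul_inverse_cancel _ hu).symm) v)⟩
  have h4 : Ring.inverse (cayleyVar f w + 1) ((cayleyVar f w + 1) u) = u :=
    congr($(Ring.inverse_mul_cancel _ hu) u)
  rw [mul_apply_eq_comp, h4]
  set z := toHalfPlane w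
  have hone (x) : r.P 1 x = x := pencil_one r.isHilbertSum x
  -- This state is right because w(z + 1) = z - 1 coordinatewise, so P(w) sends it to P(z - 1)h(z)u.
  refine r.colligation.transfer_eq_of_apply hw (x := r.P (z + 1) (r.h z u)) ?_
  have h5 : pencil r.colligation.proj w (r.P (z + 1) (r.h z u)) = r.P (z - 1) (r.h z u) := by
    rw [← mul_toHalfPlane_add_one hw]
    exact pencil_pencil r.isHilbertSum _ _ _
  have h6 : WithLp.toLp 2 (r.P (z - 1) (r.h z u), (cayleyVar f w + 1) u) =
      WithLp.toLp 2 (r.P z (r.h z u), f z u) + WithLp.toLp 2 (-r.h z u, u) := by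
    rw [← WithLp.toLp_add]
    refine congrArg (WithLp.toLp 2) (Prod.ext ?_ rfl)
    simp only [P, pencil_sub, sub_apply]
    exact (congrArg (_ - ·) (hone _)).trans (sub_eq_add_neg _ _)
  have h7 : r.op (WithLp.toLp 2 (r.P (z - 1) (r.h z u), (cayleyVar f w + 1) u)) =
      WithLp.toLp 2 (r.P (z + 1) (r.h z u), (cayleyVar f w - 1) u) := by
    rw [h6, map_add, r.op_apply_range hz, r.op_apply_orthogonal hz, ← WithLp.toLp_neg,
      ← WithLp.toLp_add]
    refine congrArg (WithLp.toLp 2) (Prod.ext ?_ (sub_eq_add_neg _ _).symm)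
    simp only [P, pencil_add, add_apply]
    refine Eq.trans ?_ (congrArg (_ + ·) (hone _)).symm
    simp
  rw [h5]
  exact h7

end RealFactorization

end

end Bessmertnyi

/-! ### The equivalence of the four conditions -/

theorem mainTheorem6 {N : ℕ} {U : Type u} [NormedAddCommGroup U] [InnerProductSpace ℂ U]
    [CompleteSpace U] (ι : U → U) (hι : Bessmertnyi.IsAUI ι)
    (f : (Fin N → ℂ) → U →L[ℂ] U) (hf : DifferentiableOn ℂ f (Bessmertnyi.Omega N)) :
    List.TFAE [
      Bessmertnyi.IsBessmertnyi f ∧ Bessmertnyi.IsRealFun ι (Bessmertnyi.Omega N) f,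
      ∃ (H : Type u) (_ : NormedAddCommGroup H) (_ : InnerProductSpace ℂ H) (_ : CompleteSpace H)
        (A : Fin N → WithLp 2 (U × H) →L[ℂ] WithLp 2 (U × H)) (ιH : H → H),
        Bessmertnyi.IsLongResolvent f A ∧ Bessmertnyi.IsAUI ιH ∧
        Bessmertnyi.IsRealFun (Bessmertnyi.sumMap ι ιH) (Bessmertnyi.Omega N)
          (Bessmertnyi.pencil A),
      ∃ Φ : Fin N → (Fin N → ℂ) → (Fin N → ℂ) → U →L[ℂ] U,
        (∀ k, Bessmertnyi.IsHolomorphicPSDKernel (Bessmertnyi.polyHalfPlane N) (Φ k)) ∧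
        (∀ z ∈ Bessmertnyi.polyHalfPlane N, ∀ ζ ∈ Bessmertnyi.polyHalfPlane N,
          f z = ∑ k, z k • Φ k z ζ) ∧
        ∀ k, Bessmertnyi.IsRealFun ι
          (Bessmertnyi.polyHalfPlane N ×ˢ Bessmertnyi.polyHalfPlane N) (fun p => Φ k p.1 p.2),
      ∃ (α : Bessmertnyi.AglerColligation N U) (ιX : α.X → α.X),
        IsSelfAdjoint α.op ∧ Bessmertnyi.IsDoubleCayley f α.transfer ∧ Bessmertnyi.IsAUI ιX ∧
        (∀ k, Bessmertnyi.IsRealOp ιX (α.proj k)) ∧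
        Bessmertnyi.IsRealOp (Bessmertnyi.sumMap ιX ι) α.op] := by
  have hsub := Bessmertnyi.polyHalfPlane_subset_Omega (N := N)
  tfae_have 1 → 3 := by
    rintro ⟨⟨-, H, _, _, _, A, hA⟩, hreal⟩
    obtain ⟨Φ, hΦ, h⟩ := Bessmertnyi.exists_kernels_of_isLongResolvent hA
    exact Bessmertnyi.exists_real_kernels hι (fun z hz => hreal z (hsub hz)) hΦ h
  tfae_have 3 → 2 := by
    rintro ⟨Φ, hΦ, h, hreal⟩
    obtain ⟨r⟩ := Bessmertnyi.nonempty_realFactorization hι hΦ h hreal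
    exact ⟨r.K, inferInstance, inferInstance, inferInstance, r.coeff, r.conjK,
      r.isLongResolvent hf, r.isAUI_conjK, r.isRealFun_pencil hι⟩
  tfae_have 2 → 1 := by
    rintro ⟨H, _, _, _, A, κ, hA, hκ, hreal⟩
    exact ⟨⟨hf, H, inferInstance, inferInstance, inferInstance, A, hA⟩,
      Bessmertnyi.isRealFun_of_isLongResolvent hι hκ hA hreal⟩
  tfae_have 3 → 4 := by
    intro h3
    -- Reality of f itself, needed for the reflection to be real, is obtained from the implications
    -- 3 → 2 → 1.
    obtain ⟨-, hreal'⟩ := tfae_2_to_1 (tfae_3_to_2 h3)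
    obtain ⟨Φ, hΦ, h, hreal⟩ := h3
    obtain ⟨r⟩ := Bessmertnyi.nonempty_realFactorization hι hΦ h hreal
    exact ⟨r.colligation, r.conj, r.isSelfAdjoint_op, r.isDoubleCayley, r.isAUI, r.real,
      r.isRealOp_op hι fun z hz => hreal' z (hsub hz)⟩
  tfae_have 4 → 3 := by
    rintro ⟨α, κ, hsa, hα, hκ, hP, hop⟩
    exact Bessmertnyi.exists_real_kernels_of_colligation (hf.mono hsub) hι hκ hP hop hsa hα
  tfae_finish
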